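/- Let $a>b>0$, let $\omega$ be a one-dimensional standard Brownian motion on a probability space $(\Omega,\mathcal F,\mathbb P)$, and consider for $t\in I=[0,\infty)$ the Itô system with additive noise $$\begin{aligned}du&=(-a-bt\sin t)\,u\,dt+\sqrt{2b\cos t}\;e^{-at+bt\cos t}\,d\omega(t),\\ dv&=(a+bt\sin t)\,v\,dt-\sqrt{2b\cos t}\;e^{at-bt\cos t}\,d\omega(t),\end{aligned}\qquad u(0)=v(0)=1 .$$ Here scalars are taken in $\mathbb K=\mathbb R$ or $\mathbb C$, and for $r<0$ the symbol $\sqrt r$ is read as $c\sqrt{|r|}$, where $c\in\mathbb K$ is an arbitrary fixed constant ($c=i$: the principal complex root; $c=0$: no noise where $\cos t<0$; $c=1$: $\sqrt{|r|}$). Let $A(t)=\mathrm{diag}(-a-bt\sin t,\;a+bt\sin t)$ be the drift matrix. A fundamental matrix of the system is an invertible solution $\Phi$ on $I$ of $\Phi'=A\Phi$ (the homogeneous part). The system is said to satisfy the mean-square dichotomy estimates with constants $(M,\alpha,\varepsilon)$ if there are linear projections $P(t)$ of $L^2(\Omega,\mathbb K^2)$, $t\in I$, with $\Phi(t)\Phi^{-1}(s)P(s)=P(t)\Phi(t)\Phi^{-1}(s)$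 for all $t,s\in I$ and, with $Q=\mathrm{Id}-P$ and the operator norm on $L^2(\Omega,\mathbb K^2)$ (whose norm is $(\mathbb E\|\xi\|^2)^{1/2}$), $$\|\Phi(t)\Phi^{-1}(s)P(s)\|^2\le Me^{-\alpha(t-s)+\varepsilon|s|}\ (t\ge s),\qquad \|\Phi(t)\Phi^{-1}(s)Q(s)\|^2\le Me^{-\alpha(s-t)+\varepsilon|s|}\ (t\le s).$$ It admits a nonuniform mean-square exponential dichotomy (NMS-ED) if this holds for some $M,\alpha>0$, $\varepsilon\ge0$, and a uniform one (MS-ED) if it holds for some $M,\alpha>0$ with $\varepsilon=0$. Then: 1. The system admits an NMS-ED and does not admit a uniform MS-ED. 2. The estimates hold with $M=e^{4b}$, $\alpha=2(a-b)$, $\varepsilon=4b$. The factor $e^{4bs}$ is attained: for every fundamental matrix $\Phi$ and every odd $k\in\mathbb N$, with $t=4k\pi$ and $s=3k\pi$, $$\big|(\Phi(t)\Phi^{-1}(s))_{11}\big|^2=\big|(\Phi(s)\Phi^{-1}(t))_{22}\big|^2=e^{-2(a-b)(t-s)+4bs}.$$ 3. The initial value problem has a solution (adapted, almost surely continuous),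 and every solution $(u,v)$ is square integrable at each time $t\ge0$. There are $M,\alpha>0$ and $\varepsilon\ge0$ with $$\mathbb E|u(t)|^2\le Me^{-\alpha(t-s)+\varepsilon|s|}\,\mathbb E|u(s)|^2\ (t\ge s\ge0),\qquad \mathbb E|v(t)|^2\le Me^{-\alpha(s-t)+\varepsilon|s|}\,\mathbb E|v(s)|^2\ (0\le t\le s).$$ Neither of these two estimates holds with $\varepsilon=0$, for any choice of $M,\alpha>0$. Moreover, for odd $k\in\mathbb N$, $t=4k\pi$ and $s=3k\pi$, $\ \mathbb E|u(t)|^2\ge e^{-2(a-b)(t-s)+4bs}\,\mathbb E|u(s)|^2$. -/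

import Mathlib

open MeasureTheory ProbabilityTheory Filter Topology
open scoped NNReal ENNReal

noncomputable section

/-- An `n`-dimensional linear Itô equation with additive noise ("linear in the narrow sense")
`dx(t) = A(t) x(t) dt + g(t) dω(t)`, `t ≥ 0`, driven by a scalar Brownian motion.
`drift` is `A` and `noise` is `g`; only the values at times `t ≥ 0` matter.
The scalars `𝕜` are `ℝ` or `ℂ`. -/
structure AdditiveLinearSDE (𝕜 : Type*) [RCLike 𝕜] (n : ℕ) where
  drift : ℝ → Matrix (Fin n) (Fin n) 𝕜
  noise : ℝ → EuclideanSpace 𝕜 (Fin n)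

section Integral

variable {𝕜 : Type*} [RCLike 𝕜] {n : ℕ} {Ω : Type*} [MeasurableSpace Ω]

/-- The left-endpoint sum `∑ i < N, (ω(t (i+1) / N) - ω(t i / N)) g(t i / N)`. -/
def itoSum (W : ℝ≥0 → Ω → ℝ) (g : ℝ → EuclideanSpace 𝕜 (Fin n)) (t : ℝ) (N : ℕ) (w : Ω) :
    EuclideanSpace 𝕜 (Fin n) :=
  ∑ i ∈ Finset.range N,
    ((W (t * (i + 1) / N).toNNReal w - W (t * i / N).toNNReal w : ℝ) : 𝕜) • g (t * i / N)

/-- `Y` is (a version of) the Itô integral `∫₀ᵗ g(s) dω(s)` of a deterministic continuous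
function `g`: the limit in mean square of the left-endpoint sums. -/
def IsItoIntegral (P : Measure Ω) (W : ℝ≥0 → Ω → ℝ) (g : ℝ → EuclideanSpace 𝕜 (Fin n)) (t : ℝ)
    (Y : Ω → EuclideanSpace 𝕜 (Fin n)) : Prop :=
  MemLp Y 2 P ∧ Tendsto (fun N : ℕ => eLpNorm (itoSum W g t N - Y) 2 P) atTop (𝓝 0)

/-- `X` is a (strong) solution on `[0, ∞)` of the equation `S` with `X(0) = x₀`: it is adapted to
the completed filtration of the Brownian motion `W`, has almost surely continuous paths, and
`X(t) = x₀ + ∫₀ᵗ A(s) X(s) ds + ∫₀ᵗ g(s) dω(s)` almost surely, for every `t ≥ 0`. -/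
structure AdditiveLinearSDE.IsSolution (S : AdditiveLinearSDE 𝕜 n) (P : Measure Ω)
    (W : ℝ≥0 → Ω → ℝ) (x₀ : EuclideanSpace 𝕜 (Fin n))
    (X : ℝ → Ω → EuclideanSpace 𝕜 (Fin n)) : Prop where
  adapted : ∀ t, 0 ≤ t →
    AEStronglyMeasurable[⨆ r : Set.Iic t.toNNReal,
      MeasurableSpace.comap (W r) (borel ℝ)] (X t) P
  continuous_paths : ∀ᵐ w ∂P, ContinuousOn (fun t => X t w) (Set.Ici 0)
  equation : ∀ t, 0 ≤ t → ∃ Y : Ω → EuclideanSpace 𝕜 (Fin n), IsItoIntegral P W S.noise t Y ∧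
    ∀ᵐ w ∂P, X t w =
      x₀ + (∫ s in (0 : ℝ)..t, Matrix.toEuclideanCLM (𝕜 := 𝕜) (S.drift s) (X s w)) + Y w

end Integral

section Dichotomy

variable {𝕜 : Type*} [RCLike 𝕜] {n : ℕ} {Ω : Type*} [MeasurableSpace Ω]

/-- `Φ` is a fundamental matrix solution on `[0, ∞)` of the equation `S`, that is, of its
homogeneous part `dx(t) = A(t) x(t) dt`: `Φ' = A Φ`, with `Φ(t)` invertible. -/
def AdditiveLinearSDE.IsFundamentalMatrix (S : AdditiveLinearSDE 𝕜 n)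
    (Φ : ℝ → Matrix (Fin n) (Fin n) 𝕜) : Prop :=
  ∀ t, 0 ≤ t → IsUnit (Φ t).det ∧
    ∀ i j, HasDerivWithinAt (fun r => Φ r i j) ((S.drift t * Φ t) i j) (Set.Ici 0) t

/-- A matrix acting pointwise on the Hilbert space `L²(Ω, 𝕜ⁿ)`. -/
def matrixL2 (P : Measure Ω) (B : Matrix (Fin n) (Fin n) 𝕜) :
    Lp (EuclideanSpace 𝕜 (Fin n)) 2 P →L[𝕜] Lp (EuclideanSpace 𝕜 (Fin n)) 2 P :=
  (Matrix.toEuclideanCLM (𝕜 := 𝕜) B).compLpL 2 P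

/-- The mean-square dichotomy estimates on `I = [0, ∞)` with bound `M`, exponent `α` and
nonuniform degree `ε`: there are linear projections `Pr(t)` of `L²(Ω, 𝕜ⁿ)`, with complementary
projections `Q(t) = Id - Pr(t)`, such that `Φ(t) Φ⁻¹(s) Pr(s) = Pr(t) Φ(t) Φ⁻¹(s)` and
`E‖Φ(t) Φ⁻¹(s) Pr(s)‖² ≤ M exp(-α(t-s) + ε|s|)` for `t ≥ s`,
`E‖Φ(t) Φ⁻¹(s) Q(s)‖² ≤ M exp(-α(s-t) + ε|s|)` for `t ≤ s`.
The estimates are on the operators of `L²(Ω, 𝕜ⁿ)`, whose norm is `‖ξ‖² = E‖ξ‖²`. -/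
def AdditiveLinearSDE.HasMSDichotomy (S : AdditiveLinearSDE 𝕜 n) (P : Measure Ω)
    (M α ε : ℝ) : Prop :=
  ∃ Φ : ℝ → Matrix (Fin n) (Fin n) 𝕜, S.IsFundamentalMatrix Φ ∧
  ∃ Pr : ℝ → (Lp (EuclideanSpace 𝕜 (Fin n)) 2 P →ₗ[𝕜] Lp (EuclideanSpace 𝕜 (Fin n)) 2 P),
    (∀ t, 0 ≤ t → ∀ ξ, Pr t (Pr t ξ) = Pr t ξ) ∧
    (∀ t s, 0 ≤ t → 0 ≤ s → ∀ ξ,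
      matrixL2 P (Φ t * (Φ s)⁻¹) (Pr s ξ) = Pr t (matrixL2 P (Φ t * (Φ s)⁻¹) ξ)) ∧
    (∀ t s, 0 ≤ s → s ≤ t → ∀ ξ,
      ‖matrixL2 P (Φ t * (Φ s)⁻¹) (Pr s ξ)‖ ^ 2
        ≤ M * Real.exp (-α * (t - s) + ε * |s|) * ‖ξ‖ ^ 2) ∧
    (∀ t s, 0 ≤ t → t ≤ s → ∀ ξ,
      ‖matrixL2 P (Φ t * (Φ s)⁻¹) (ξ - Pr s ξ)‖ ^ 2
        ≤ M * Real.exp (-α * (s - t) + ε * |s|) * ‖ξ‖ ^ 2)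

/-- Nonuniform mean-square exponential dichotomy (NMS-ED) on `[0, ∞)`. -/
def AdditiveLinearSDE.AdmitsNMSED (S : AdditiveLinearSDE 𝕜 n) (P : Measure Ω) : Prop :=
  ∃ M α ε : ℝ, 0 < M ∧ 0 < α ∧ 0 ≤ ε ∧ S.HasMSDichotomy P M α ε

/-- (Uniform) mean-square exponential dichotomy (MS-ED) on `[0, ∞)`. -/
def AdditiveLinearSDE.AdmitsUniformMSED (S : AdditiveLinearSDE 𝕜 n) (P : Measure Ω) : Prop :=
  ∃ M α : ℝ, 0 < M ∧ 0 < α ∧ S.HasMSDichotomy P M α 0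

end Dichotomy

/-- The square root of a real number `r`, read as the usual `√r` for `r ≥ 0` and as `c √|r|` for
`r < 0`. Thus `c = i` is the principal complex root, `c = 0` the root of the positive part, and
`c = 1` the root of the absolute value. (`Real.sqrt` vanishes at negative numbers.) -/
def sqrtWith {𝕜 : Type*} [RCLike 𝕜] (c : 𝕜) (r : ℝ) : 𝕜 :=
  (Real.sqrt r : 𝕜) + c * (Real.sqrt (-r) : 𝕜)

/-- The system
`du = (-a - b t sin t) u dt + √(2 b cos t) exp(-a t + b t cos t) dω`,
`dv = (a + b t sin t) v dt - √(2 b cos t) exp(a t - b t cos t) dω`,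
where roots of negative numbers are read as in `sqrtWith c`. -/
def exampleSDE {𝕜 : Type*} [RCLike 𝕜] (a b : ℝ) (c : 𝕜) : AdditiveLinearSDE 𝕜 2 where
  drift t := !![((-a - b * t * Real.sin t : ℝ) : 𝕜), 0;
                0, ((a + b * t * Real.sin t : ℝ) : 𝕜)]
  noise t := !₂[sqrtWith c (2 * b * Real.cos t) * (Real.exp (-a * t + b * t * Real.cos t) : 𝕜),
                -(sqrtWith c (2 * b * Real.cos t) * (Real.exp (a * t - b * t * Real.cos t) : 𝕜))]

/-- The second moment `E|f|²`. -/
def secondMoment {𝕜 : Type*} [RCLike 𝕜] {Ω : Type*} [MeasurableSpace Ω] (P : Measure Ω)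
    (f : Ω → 𝕜) : ℝ :=
  ∫ w, ‖f w‖ ^ 2 ∂P

end

/-!
The homogeneous equations are solved by `φ(t) = exp (-a t + b t cos t - b sin t)` (`homSol`) and
`1 / φ(t)`, so every fundamental matrix has the transition matrices
`diag (φ(t) / φ(s), φ(s) / φ(t))` (`transition_eq`). Since `|cos| ≤ 1` and `|sin| ≤ 1`,
`φ(t)² / φ(s)² ≤ e^{4 b} e^{-2 (a - b) (t - s) + 4 b s}` for `s ≤ t` (`homSol_sq_le`), which gives
the dichotomy with the projection onto the first coordinate. From `s = (2 k + 1) π` to `s + π` the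
function `φ` grows by a factor that is unbounded in `k` (`homSol_half_period`). This excludes a
uniform dichotomy, once it is known that its projections fix the constant vector `(1, 0)`
(`not_admitsUniformMSED_example`).

For the stochastic equation, the Itô integral of the deterministic integrand `g` is constructed path
by path as `B(t) g(t) - ∫₀ᵗ B g' ds` (`wienerIntegral`). The noise coefficient contains
`√(2 b cos t)`, whose derivative is unbounded near the zeros of the cosine, but it is integrable,
because the root is monotone on either side of each zero (`hasIntegrableDeriv_sqrt_cos`). Summation
by parts writes the difference between the left-endpoint sums and this integral through increments
of `B` over short intervals, which tend to `0` in mean square (`tendsto_leftSum`). The pathwise formula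
has continuous paths, obeys the product rule (`smul_wienerIntegral_eq`), and so yields the solution
`u = φ (1 + ∫ h₁ dB)`, `v = φ⁻¹ (1 + ∫ h₂ dB)` by variation of constants, where `φ h₁` and `φ⁻¹ h₂`
are the noise coefficients (`isSolution_variationOfConstants`). Two solutions agree almost surely,
as their difference solves the homogeneous equation path by path (`isSolution_ae_eq`).

By the Itô isometry `E|u(t)|² = φ(t)² (1 + J₁(t))` and `E|v(t)|² = φ(t)⁻² (1 + J₂(t))`, where
`Jᵢ(t) = ∫₀ᵗ |hᵢ|² ds` is nondecreasing with bounded slope (`secondMoment_solution`,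
`exists_noiseVariance_sub_le`). The factors `1 + Jᵢ` thus grow at most linearly: they cost part of
the exponential rate, and they cannot compensate for the growth of `φ` over half periods.
-/

noncomputable section

/-! ### The homogeneous equation -/

/-- A solution of the scalar equation `y' = r y` on `[0, ∞)` is a multiple of any solution `φ`
without zeros. -/
lemma eq_smul_of_hasDerivWithinAt {E : Type*} [NormedAddCommGroup E] [NormedSpace ℝ E]
    {φ r : ℝ → ℝ} (hφ : ∀ t, HasDerivAt φ (r t * φ t) t) (hφ0 : ∀ t, φ t ≠ 0) {y : ℝ → E}
    (hy : ∀ t, 0 ≤ t → HasDerivWithinAt y (r t • y t) (Set.Ici 0) t) {t : ℝ} (ht : 0 ≤ t) :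
    y t = (φ t / φ 0) • y 0 := by
  -- the quotient `y / φ` has vanishing derivative
  have hd : ∀ x, 0 ≤ x → HasDerivWithinAt (fun x => (φ x)⁻¹ • y x) 0 (Set.Ici 0) x := by
    intro x hx
    have := ((hφ x).inv (hφ0 x)).hasDerivWithinAt (s := Set.Ici 0) |>.smul (hy x hx)
    refine this.congr_deriv ?_
    have := hφ0 x
    rw [smul_smul, ← add_smul, Pi.inv_apply,
      show (φ x)⁻¹ * r x + -(r x * φ x) / φ x ^ 2 = 0 by field_simp; ring, zero_smul]
  have hc := constant_of_has_deriv_right_zero (a := 0) (b := t)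
    (fun x hx => (hd x hx.1).continuousWithinAt.mono Set.Icc_subset_Ici_self)
    (fun x hx => (hd x hx.1).mono (Set.Ici_subset_Ici.2 hx.1)) t ⟨ht, le_rfl⟩
  rw [div_eq_mul_inv, mul_smul, ← hc, smul_smul, mul_inv_cancel₀ (hφ0 t), one_smul]

lemma HasDerivAt.rclike_ofReal {𝕜 : Type*} [RCLike 𝕜] {f : ℝ → ℝ} {f' t : ℝ}
    (hf : HasDerivAt f f' t) : HasDerivAt (fun t => (f t : 𝕜)) (f' : 𝕜) t :=
  (RCLike.ofRealCLM (K := 𝕜)).hasFDerivAt.comp_hasDerivAt t hf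

/-- The solution `exp (∫₀ᵗ (-a - b s sin s) ds)` of the first homogeneous equation. The second
homogeneous equation is solved by its reciprocal. -/
def homSol (a b t : ℝ) : ℝ := Real.exp (-a * t + b * t * Real.cos t - b * Real.sin t)

lemma homSol_pos (a b t : ℝ) : 0 < homSol a b t := Real.exp_pos _

lemma homSol_ne_zero (a b t : ℝ) : homSol a b t ≠ 0 := (homSol_pos a b t).ne'

@[simp] lemma homSol_zero (a b : ℝ) : homSol a b 0 = 1 := by simp [homSol]

lemma hasDerivAt_homSol (a b t : ℝ) :
    HasDerivAt (homSol a b) ((-a - b * t * Real.sin t) * homSol a b t) t := by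
  have h : HasDerivAt (fun t => -a * t + b * t * Real.cos t - b * Real.sin t)
      (-a - b * t * Real.sin t) t := by
    have h1 := ((hasDerivAt_id t).const_mul (-a)).add
      (((hasDerivAt_id t).const_mul b).mul (Real.hasDerivAt_cos t))
    refine (h1.sub ((Real.hasDerivAt_sin t).const_mul b)).congr_deriv ?_
    simp only [id]; ring
  exact h.exp.congr_deriv (mul_comm _ _)

lemma hasDerivAt_homSol_inv (a b t : ℝ) :
    HasDerivAt (fun t => (homSol a b t)⁻¹) ((a + b * t * Real.sin t) * (homSol a b t)⁻¹) t := by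
  refine ((hasDerivAt_homSol a b t).inv (homSol_ne_zero a b t)).congr_deriv ?_
  have := homSol_ne_zero a b t
  field_simp; ring

lemma continuous_homSol (a b : ℝ) : Continuous (homSol a b) :=
  continuous_iff_continuousAt.2 fun t => (hasDerivAt_homSol a b t).continuousAt

/-- The estimate behind the dichotomy, with the nonuniform factor `e^{4 b s}`: the exponent of
`φ(t) / φ(s)` is at most `-a (t - s) + b t + b s + 2 b = -(a - b) (t - s) + 2 b s + 2 b`. -/
lemma homSol_sq_le {a b s t : ℝ} (hb : 0 < b) (hs : 0 ≤ s) (hst : s ≤ t) :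
    homSol a b t ^ 2 ≤
      Real.exp (4 * b) * Real.exp (-(2 * (a - b)) * (t - s) + 4 * b * s) * homSol a b s ^ 2 := by
  simp only [homSol, ← Real.exp_nat_mul, ← Real.exp_add]
  apply Real.exp_le_exp.2
  push_cast
  have h1 : t * Real.cos t ≤ t * 1 :=
    mul_le_mul_of_nonneg_left (Real.cos_le_one t) (hs.trans hst)
  have h2 : s * (-1) ≤ s * Real.cos s := mul_le_mul_of_nonneg_left (Real.neg_one_le_cos s) hs
  have h3 : t * Real.cos t - Real.sin t - s * Real.cos s + Real.sin s ≤ t + s + 2 := by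
    linarith [Real.neg_one_le_sin t, Real.sin_le_one s]
  nlinarith [mul_le_mul_of_nonneg_left h3 hb.le]

lemma sin_odd_mul_pi (k : ℕ) : Real.sin ((2 * k + 1) * Real.pi) = 0 := by
  have := Real.sin_nat_mul_pi (2 * k + 1)
  push_cast at this; exact this

lemma cos_odd_mul_pi (k : ℕ) : Real.cos ((2 * k + 1) * Real.pi) = -1 := by
  rw [show (2 * (k : ℝ) + 1) * Real.pi = Real.pi + k * (2 * Real.pi) by ring,
    Real.cos_add_nat_mul_two_pi, Real.cos_pi]

/-- Over half a period starting at an odd multiple of `π` the solution of the first homogeneous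
equation grows by a factor that is unbounded in the starting time. -/
lemma homSol_half_period (a b : ℝ) (k : ℕ) :
    homSol a b ((2 * k + 1) * Real.pi + Real.pi) ^ 2 =
      Real.exp (-2 * a * Real.pi + 2 * b * (4 * k + 3) * Real.pi) *
        homSol a b ((2 * k + 1) * Real.pi) ^ 2 := by
  simp only [homSol, Real.sin_add_pi, Real.cos_add_pi, sin_odd_mul_pi, cos_odd_mul_pi,
    ← Real.exp_nat_mul, ← Real.exp_add]
  congr 1
  push_cast; ring

/-- At `t = 4kπ` and `s = 3kπ` the cosine has the extreme values `1` and `-1` that `homSol_sq_le`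
allows for. -/
lemma homSol_peak (a b : ℝ) {k : ℕ} (hk : Odd k) :
    homSol a b (4 * k * Real.pi) ^ 2 =
      Real.exp (-2 * (a - b) * (4 * k * Real.pi - 3 * k * Real.pi) + 4 * b * (3 * k * Real.pi)) *
        homSol a b (3 * k * Real.pi) ^ 2 := by
  obtain ⟨m, rfl⟩ := hk
  have h1 : Real.cos (4 * ((2 * m + 1 : ℕ) : ℝ) * Real.pi) = 1 := by
    rw [show 4 * ((2 * m + 1 : ℕ) : ℝ) * Real.pi = ((2 * (2 * m + 1) : ℕ) : ℝ) * (2 * Real.pi) by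
      push_cast; ring, Real.cos_nat_mul_two_pi]
  have h2 : Real.sin (4 * ((2 * m + 1 : ℕ) : ℝ) * Real.pi) = 0 := by
    have := Real.sin_nat_mul_pi (4 * (2 * m + 1))
    push_cast at this ⊢; exact this
  have h3 : 3 * ((2 * m + 1 : ℕ) : ℝ) * Real.pi = (2 * ((3 * m + 1 : ℕ) : ℝ) + 1) * Real.pi := by
    push_cast; ring
  have h4 : Real.cos (3 * ((2 * m + 1 : ℕ) : ℝ) * Real.pi) = -1 := by
    rw [h3, cos_odd_mul_pi]
  have h5 : Real.sin (3 * ((2 * m + 1 : ℕ) : ℝ) * Real.pi) = 0 := by rw [h3, sin_odd_mul_pi]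
  simp only [homSol, h1, h2, h4, h5, ← Real.exp_nat_mul, ← Real.exp_add]
  congr 1
  push_cast; ring

/-- No uniform exponential bound survives the growth over half periods. -/
lemma exists_half_period_gt (a : ℝ) {b : ℝ} (hb : 0 < b) (C : ℝ) :
    ∃ k : ℕ, C < Real.exp (-2 * a * Real.pi + 2 * b * (4 * k + 3) * Real.pi) := by
  have h : Tendsto (fun k : ℕ => -2 * a * Real.pi + 2 * b * (4 * k + 3) * Real.pi) atTop atTop := by
    have h1 : Tendsto (fun k : ℕ => (8 * b * Real.pi) * (k : ℝ)) atTop atTop :=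
      tendsto_natCast_atTop_atTop.const_mul_atTop (by positivity)
    refine (tendsto_atTop_add_const_left _ (-2 * a * Real.pi + 6 * b * Real.pi) h1).congr ?_
    intro k; ring
  exact ((Real.tendsto_exp_atTop.comp h).eventually_gt_atTop C).exists

section FundamentalMatrix

variable {𝕜 : Type*} [RCLike 𝕜]

/-- Every fundamental matrix of the system has the diagonal transition matrices
`diag (φ(t) / φ(s), φ(s) / φ(t))`. -/
lemma transition_eq {a b : ℝ} {c : 𝕜} {Φ : ℝ → Matrix (Fin 2) (Fin 2) 𝕜}
    (hΦ : (exampleSDE a b c).IsFundamentalMatrix Φ) {t s : ℝ} (ht : 0 ≤ t) (hs : 0 ≤ s) :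
    Φ t * (Φ s)⁻¹ = Matrix.diagonal
      ![((homSol a b t / homSol a b s : ℝ) : 𝕜), ((homSol a b s / homSol a b t : ℝ) : 𝕜)] := by
  have key : ∀ t, 0 ≤ t → Φ t = Matrix.diagonal
      ![((homSol a b t : ℝ) : 𝕜), (((homSol a b t)⁻¹ : ℝ) : 𝕜)] * Φ 0 := by
    intro t ht
    ext i j
    fin_cases i
    · have := eq_smul_of_hasDerivWithinAt (hasDerivAt_homSol a b) (homSol_ne_zero a b)
        (y := fun r => Φ r 0 j) (fun t ht => ((hΦ t ht).2 0 j).congr_deriv (by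
          simp [exampleSDE, Matrix.mul_apply, Fin.sum_univ_two, RCLike.real_smul_eq_coe_mul])) ht
      simpa [Matrix.diagonal_mul, RCLike.real_smul_eq_coe_mul] using this
    · have := eq_smul_of_hasDerivWithinAt (hasDerivAt_homSol_inv a b)
        (fun t => inv_ne_zero (homSol_ne_zero a b t))
        (y := fun r => Φ r 1 j) (fun t ht => ((hΦ t ht).2 1 j).congr_deriv (by
          simp [exampleSDE, Matrix.mul_apply, Fin.sum_univ_two, RCLike.real_smul_eq_coe_mul])) ht
      simpa [Matrix.diagonal_mul, RCLike.real_smul_eq_coe_mul] using this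
  have hdet := (hΦ s hs).1
  have hD : Φ t = Matrix.diagonal
      ![((homSol a b t / homSol a b s : ℝ) : 𝕜), ((homSol a b s / homSol a b t : ℝ) : 𝕜)] * Φ s := by
    have hs0 : (homSol a b s : 𝕜) ≠ 0 := RCLike.ofReal_ne_zero.2 (homSol_ne_zero a b s)
    rw [key t ht, key s hs, ← Matrix.mul_assoc, Matrix.diagonal_mul_diagonal]
    congr 2
    ext i
    fin_cases i <;> simp <;> field_simp
  rw [hD, Matrix.mul_assoc, Matrix.mul_nonsing_inv _ hdet, Matrix.mul_one]

lemma exists_fundamentalMatrix (a b : ℝ) (c : 𝕜) :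
    ∃ Φ, (exampleSDE a b c).IsFundamentalMatrix Φ := by
  refine ⟨fun t => Matrix.diagonal ![((homSol a b t : ℝ) : 𝕜), (((homSol a b t)⁻¹ : ℝ) : 𝕜)],
    fun t _ => ⟨?_, fun i j => ?_⟩⟩
  · have := homSol_ne_zero a b t
    simp [Matrix.det_diagonal, this]
  · have h1 := (hasDerivAt_homSol a b t).rclike_ofReal (𝕜 := 𝕜) |>.hasDerivWithinAt (s := Set.Ici 0)
    have h2 := (hasDerivAt_homSol_inv a b t).rclike_ofReal (𝕜 := 𝕜)
      |>.hasDerivWithinAt (s := Set.Ici 0)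
    fin_cases i <;> fin_cases j
    · simpa [exampleSDE, Matrix.mul_apply, Fin.sum_univ_two] using h1
    · simpa [exampleSDE, Matrix.mul_apply, Fin.sum_univ_two] using hasDerivWithinAt_const _ _ _
    · simpa [exampleSDE, Matrix.mul_apply, Fin.sum_univ_two] using hasDerivWithinAt_const _ _ _
    · simpa [exampleSDE, Matrix.mul_apply, Fin.sum_univ_two] using h2

end FundamentalMatrix

/-! ### Mean-square dichotomies -/

section Dichotomy

variable {𝕜 : Type*} [RCLike 𝕜] {n : ℕ} {Ω : Type*} [MeasurableSpace Ω] (P : Measure Ω)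

lemma coeFn_matrixL2 (B : Matrix (Fin n) (Fin n) 𝕜) (ξ : Lp (EuclideanSpace 𝕜 (Fin n)) 2 P) :
    ∀ᵐ w ∂P, matrixL2 P B ξ w = Matrix.toEuclideanCLM (𝕜 := 𝕜) B (ξ w) :=
  ContinuousLinearMap.coeFn_compLpL _ _

lemma matrixL2_mul (A B : Matrix (Fin n) (Fin n) 𝕜) (ξ : Lp (EuclideanSpace 𝕜 (Fin n)) 2 P) :
    matrixL2 P (A * B) ξ = matrixL2 P A (matrixL2 P B ξ) := by
  apply Lp.ext
  filter_upwards [coeFn_matrixL2 P (A * B) ξ, coeFn_matrixL2 P A (matrixL2 P B ξ),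
    coeFn_matrixL2 P B ξ] with w h1 h2 h3
  rw [h1, h2, h3, map_mul]; rfl

lemma matrixL2_smul (r : 𝕜) (B : Matrix (Fin n) (Fin n) 𝕜)
    (ξ : Lp (EuclideanSpace 𝕜 (Fin n)) 2 P) :
    matrixL2 P (r • B) ξ = r • matrixL2 P B ξ := by
  apply Lp.ext
  filter_upwards [coeFn_matrixL2 P (r • B) ξ, coeFn_matrixL2 P B ξ,
    Lp.coeFn_smul r (matrixL2 P B ξ)] with w h1 h2 h3
  rw [h1, h3, Pi.smul_apply, h2, map_smul]; rfl

lemma matrixL2_one (ξ : Lp (EuclideanSpace 𝕜 (Fin n)) 2 P) : matrixL2 P 1 ξ = ξ := by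
  apply Lp.ext
  filter_upwards [coeFn_matrixL2 P 1 ξ] with w h1
  rw [h1, map_one]; rfl

lemma matrixL2_add (A B : Matrix (Fin n) (Fin n) 𝕜) (ξ : Lp (EuclideanSpace 𝕜 (Fin n)) 2 P) :
    matrixL2 P (A + B) ξ = matrixL2 P A ξ + matrixL2 P B ξ := by
  apply Lp.ext
  filter_upwards [coeFn_matrixL2 P (A + B) ξ, coeFn_matrixL2 P A ξ, coeFn_matrixL2 P B ξ,
    Lp.coeFn_add (matrixL2 P A ξ) (matrixL2 P B ξ)] with w h1 h2 h3 h4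
  rw [h1, h4, Pi.add_apply, h2, h3, map_add]; rfl

/-- A coordinate projection does not increase the norm of `L²`. -/
lemma norm_matrixL2_single_le (i : Fin n) (ξ : Lp (EuclideanSpace 𝕜 (Fin n)) 2 P) :
    ‖matrixL2 P (Matrix.diagonal (Pi.single i 1)) ξ‖ ≤ ‖ξ‖ := by
  apply Lp.norm_le_norm_of_ae_le
  filter_upwards [coeFn_matrixL2 P (Matrix.diagonal (Pi.single i 1)) ξ] with w h
  rw [h, EuclideanSpace.norm_eq, EuclideanSpace.norm_eq]
  refine Real.sqrt_le_sqrt (Finset.sum_le_sum fun j _ => ?_)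
  rw [Matrix.ofLp_toEuclideanCLM, Matrix.mulVec_diagonal]
  by_cases hj : j = i
  · subst hj; simp
  · simp [hj]

lemma matrixL2_single_add (ξ : Lp (EuclideanSpace 𝕜 (Fin 2)) 2 P) :
    matrixL2 P (Matrix.diagonal (Pi.single 0 1)) ξ + matrixL2 P (Matrix.diagonal (Pi.single 1 1)) ξ
      = ξ := by
  rw [← matrixL2_add, Matrix.diagonal_add]
  convert matrixL2_one P ξ
  rw [← Matrix.diagonal_one]
  congr 1
  ext i
  fin_cases i <;> simp

lemma matrixL2_diagonal_single (d : Fin n → 𝕜) (i : Fin n)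
    (ξ : Lp (EuclideanSpace 𝕜 (Fin n)) 2 P) :
    matrixL2 P (Matrix.diagonal d) (matrixL2 P (Matrix.diagonal (Pi.single i 1)) ξ)
      = d i • matrixL2 P (Matrix.diagonal (Pi.single i 1)) ξ := by
  rw [← matrixL2_mul, ← matrixL2_smul, Matrix.diagonal_mul_diagonal, ← Matrix.diagonal_smul]
  congr 3
  ext j
  by_cases hj : j = i
  · subst hj; simp
  · simp [hj]

lemma matrixL2_diagonal_comm (d e : Fin n → 𝕜) (ξ : Lp (EuclideanSpace 𝕜 (Fin n)) 2 P) :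
    matrixL2 P (Matrix.diagonal d) (matrixL2 P (Matrix.diagonal e) ξ)
      = matrixL2 P (Matrix.diagonal e) (matrixL2 P (Matrix.diagonal d) ξ) := by
  rw [← matrixL2_mul, ← matrixL2_mul, Matrix.diagonal_mul_diagonal, Matrix.diagonal_mul_diagonal]
  simp_rw [mul_comm]

/-- The dichotomy estimates hold with the coordinate projection `(u, v) ↦ (u, 0)`. -/
lemma hasMSDichotomy_example {a b : ℝ} (hb : 0 < b) (c : 𝕜) :
    (exampleSDE a b c).HasMSDichotomy P (Real.exp (4 * b)) (2 * (a - b)) (4 * b) := by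
  obtain ⟨Φ, hΦ⟩ := exists_fundamentalMatrix a b c
  refine ⟨Φ, hΦ, fun _ => (matrixL2 P (Matrix.diagonal (Pi.single 0 1))).toLinearMap,
    ?_, ?_, ?_, ?_⟩
  · intro t _ ξ
    simp only [ContinuousLinearMap.coe_coe]
    rw [matrixL2_diagonal_single]; simp
  · intro t s ht hs ξ
    simp only [ContinuousLinearMap.coe_coe, transition_eq hΦ ht hs]
    exact matrixL2_diagonal_comm P _ _ ξ
  · intro t s hs hst ξ
    simp only [ContinuousLinearMap.coe_coe, transition_eq hΦ (hs.trans hst) hs]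
    rw [matrixL2_diagonal_single, norm_smul, mul_pow]
    gcongr
    · simp only [Matrix.cons_val_zero, RCLike.norm_ofReal, sq_abs, div_pow]
      rw [div_le_iff₀ (pow_pos (homSol_pos a b s) 2), abs_of_nonneg hs]
      exact homSol_sq_le hb hs hst
    · exact norm_matrixL2_single_le P 0 ξ
  · intro t s ht hts ξ
    simp only [ContinuousLinearMap.coe_coe, transition_eq hΦ ht (ht.trans hts)]
    have hξ : ξ - matrixL2 P (Matrix.diagonal (Pi.single 0 1)) ξ
        = matrixL2 P (Matrix.diagonal (Pi.single 1 1)) ξ :=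
      sub_eq_of_eq_add' (matrixL2_single_add P ξ).symm
    rw [hξ, matrixL2_diagonal_single, norm_smul, mul_pow]
    gcongr
    · simp only [Matrix.cons_val_one, Matrix.cons_val_fin_one, RCLike.norm_ofReal, sq_abs, div_pow]
      rw [div_le_iff₀ (pow_pos (homSol_pos a b t) 2), abs_of_nonneg (ht.trans hts)]
      refine (homSol_sq_le hb ht hts).trans ?_
      gcongr
    · exact norm_matrixL2_single_le P 1 ξ

/-- In a uniform dichotomy the projections would have to fix the constant vector `(1, 0)`, whose
orbit is `(φ(t), 0)`: the second component of a vector in the stable space grows, and the first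
component of a vector in the unstable space decays. But `φ` grows without uniform bound over half
periods. -/
lemma not_admitsUniformMSED_example [IsProbabilityMeasure P] {a b : ℝ} (hb : 0 < b) (hab : b < a)
    (c : 𝕜) : ¬ (exampleSDE a b c).AdmitsUniformMSED P := by
  rintro ⟨M, α, hM, hα, Φ, hΦ, Pr, -, hinv, hst, hun⟩
  set p : Fin 2 → Lp (EuclideanSpace 𝕜 (Fin 2)) 2 P →L[𝕜] Lp (EuclideanSpace 𝕜 (Fin 2)) 2 P :=
    fun i => matrixL2 P (Matrix.diagonal (Pi.single i 1)) with hp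
  set φ := homSol a b
  have hφ0 : φ 0 = 1 := homSol_zero a b
  have hφpos : ∀ t, 0 < φ t := homSol_pos a b
  have hφle : ∀ t, 0 ≤ t → φ t ^ 2 ≤ Real.exp (4 * b) := by
    intro t ht
    have h := homSol_sq_le (a := a) hb le_rfl ht
    rw [homSol_zero, one_pow, mul_one] at h
    refine h.trans (mul_le_of_le_one_right (Real.exp_pos _).le (Real.exp_le_one_iff.2 ?_))
    nlinarith [mul_nonneg (sub_pos.2 hab).le ht]
  -- the quantity that bounds the components that have to vanish
  have hlim : ∀ ξ : Lp (EuclideanSpace 𝕜 (Fin 2)) 2 P, Tendsto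
      (fun t => Real.exp (4 * b) * (M * Real.exp (-α * t) * ‖ξ‖ ^ 2)) atTop (𝓝 0) := by
    intro ξ
    have : Tendsto (fun t => Real.exp (-α * t)) atTop (𝓝 0) :=
      Real.tendsto_exp_atBot.comp (tendsto_id.const_mul_atTop_of_neg (neg_lt_zero.2 hα))
    simpa using ((this.const_mul M).mul_const (‖ξ‖ ^ 2)).const_mul (Real.exp (4 * b))
  have hvanish : ∀ ξ η : Lp (EuclideanSpace 𝕜 (Fin 2)) 2 P,
      (∀ t, 0 ≤ t → ‖η‖ ^ 2 ≤ φ t ^ 2 * (M * Real.exp (-α * t) * ‖ξ‖ ^ 2)) → η = 0 := by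
    intro ξ η h
    have h0 : ‖η‖ ^ 2 ≤ 0 := ge_of_tendsto (hlim ξ) (by
      filter_upwards [eventually_ge_atTop 0] with t ht
      exact (h t ht).trans (by gcongr; exact hφle t ht))
    exact norm_eq_zero.1 (pow_eq_zero_iff two_ne_zero |>.1 (le_antisymm h0 (by positivity)))
  -- the second component of a vector in the range of `Pr 0` is multiplied by `1 / φ(t)`, which
  -- does not decay
  have hstable : ∀ ξ, p 1 (Pr 0 ξ) = 0 := by
    refine fun ξ => hvanish ξ _ fun t ht => ?_
    have h1 := hst t 0 le_rfl ht ξ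
    rw [transition_eq hΦ ht le_rfl] at h1
    have h2 := norm_matrixL2_single_le P 1
      (matrixL2 P (Matrix.diagonal ![((φ t / φ 0 : ℝ) : 𝕜), ((φ 0 / φ t : ℝ) : 𝕜)]) (Pr 0 ξ))
    rw [matrixL2_diagonal_comm, matrixL2_diagonal_single, norm_smul] at h2
    have h3 := (pow_le_pow_left₀ (by positivity) h2 2).trans h1
    simp only [Matrix.cons_val_one, Matrix.cons_val_fin_one, RCLike.norm_ofReal, hφ0, mul_pow,
      sq_abs, one_div, inv_pow, abs_zero, mul_zero, add_zero, sub_zero] at h3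
    rwa [inv_mul_le_iff₀ (pow_pos (hφpos t) 2)] at h3
  -- the constant vector `(1, 0)`
  set ξ : Lp (EuclideanSpace 𝕜 (Fin 2)) 2 P :=
    (memLp_const (EuclideanSpace.single 0 1 : EuclideanSpace 𝕜 (Fin 2))).toLp _ with hξ
  have hpξ : p 0 ξ = ξ := by
    apply Lp.ext
    filter_upwards [coeFn_matrixL2 P (Matrix.diagonal (Pi.single 0 1)) ξ,
      MemLp.coeFn_toLp (μ := P) (p := 2)
        (memLp_const (EuclideanSpace.single 0 1 : EuclideanSpace 𝕜 (Fin 2)))] with w h1 h2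
    rw [h1, h2]
    ext j
    rw [Matrix.ofLp_toEuclideanCLM, Matrix.mulVec_diagonal]
    fin_cases j <;> simp
  have hnξ : ‖ξ‖ = 1 := by
    rw [hξ, Lp.norm_toLp, eLpNorm_const _ (by simp) (IsProbabilityMeasure.ne_zero P)]
    simp
  have htrans : ∀ η, p 0 η = η → ∀ t s, 0 ≤ t → 0 ≤ s →
      matrixL2 P (Φ t * (Φ s)⁻¹) η = ((φ t / φ s : ℝ) : 𝕜) • η := by
    intro η hη t s ht hs
    have := matrixL2_diagonal_single P
      ![((φ t / φ s : ℝ) : 𝕜), ((φ s / φ t : ℝ) : 𝕜)] 0 η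
    rw [← transition_eq hΦ ht hs] at this
    change matrixL2 P (Φ t * (Φ s)⁻¹) (p 0 η) = _ • p 0 η at this
    rw [hη] at this
    simpa using this
  -- the unstable part of `(1, 0)` has only a first component, so its orbit is bounded; the backward
  -- estimate makes it vanish
  have hfix : ξ - Pr 0 ξ = 0 := by
    have hη : p 0 (ξ - Pr 0 ξ) = ξ - Pr 0 ξ := by
      have h := matrixL2_single_add P (Pr 0 ξ)
      change p 0 (Pr 0 ξ) + p 1 (Pr 0 ξ) = Pr 0 ξ at h
      rw [hstable, add_zero] at h
      rw [map_sub, hpξ, h]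
    refine hvanish ξ _ fun t ht => ?_
    have h1 := hun 0 t le_rfl ht (matrixL2 P (Φ t * (Φ 0)⁻¹) ξ)
    rw [← hinv t 0 ht le_rfl, ← map_sub, htrans _ hη t 0 ht le_rfl, map_smul,
      htrans _ hη 0 t le_rfl ht, htrans _ hpξ t 0 ht le_rfl, smul_smul, ← RCLike.ofReal_mul,
      hφ0, div_one, mul_one_div_cancel (hφpos t).ne', RCLike.ofReal_one, one_smul, norm_smul,
      RCLike.norm_ofReal, mul_pow, sq_abs, zero_mul, add_zero, sub_zero] at h1
    linarith
  obtain ⟨k, hk⟩ := exists_half_period_gt a hb M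
  set s : ℝ := (2 * k + 1) * Real.pi with hs_def
  have hs : 0 ≤ s := by positivity
  have hst' : s ≤ s + Real.pi := by linarith [Real.pi_pos]
  have h1 := hst (s + Real.pi) s hs hst' (matrixL2 P (Φ s * (Φ 0)⁻¹) ξ)
  rw [← hinv s 0 hs le_rfl, ← sub_eq_zero.1 hfix, htrans _ hpξ s 0 hs le_rfl, map_smul,
    htrans _ hpξ _ _ (hs.trans hst') hs, smul_smul, ← RCLike.ofReal_mul, hφ0, div_one,
    mul_div_cancel₀ _ (hφpos s).ne', norm_smul, norm_smul, hnξ, RCLike.norm_ofReal,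
    RCLike.norm_ofReal, mul_one, mul_one, sq_abs, sq_abs, homSol_half_period, zero_mul,
    add_zero] at h1
  have h2 := le_of_mul_le_mul_right h1 (pow_pos (hφpos s) 2)
  have h3 : M * Real.exp (-α * (s + Real.pi - s)) ≤ M :=
    mul_le_of_le_one_right hM.le (Real.exp_le_one_iff.2 (by
      nlinarith [mul_pos hα Real.pi_pos]))
  linarith

end Dichotomy

lemma norm_transition_peak {𝕜 : Type*} [RCLike 𝕜] {a b : ℝ} {c : 𝕜}
    {Φ : ℝ → Matrix (Fin 2) (Fin 2) 𝕜} (hΦ : (exampleSDE a b c).IsFundamentalMatrix Φ) {k : ℕ}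
    (hk : Odd k) :
    ‖(Φ (4 * k * Real.pi) * (Φ (3 * k * Real.pi))⁻¹) 0 0‖ ^ 2 =
        Real.exp (-2 * (a - b) * (4 * k * Real.pi - 3 * k * Real.pi)
          + 4 * b * (3 * k * Real.pi)) ∧
      ‖(Φ (3 * k * Real.pi) * (Φ (4 * k * Real.pi))⁻¹) 1 1‖ ^ 2 =
        Real.exp (-2 * (a - b) * (4 * k * Real.pi - 3 * k * Real.pi)
          + 4 * b * (3 * k * Real.pi)) := by
  have h4 : (0 : ℝ) ≤ 4 * k * Real.pi := by positivity
  have h3 : (0 : ℝ) ≤ 3 * k * Real.pi := by positivity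
  rw [transition_eq hΦ h4 h3, transition_eq hΦ h3 h4]
  simp only [Matrix.diagonal_apply_eq, Matrix.cons_val_zero, Matrix.cons_val_one,
    Matrix.cons_val_fin_one, RCLike.norm_ofReal, sq_abs, div_pow, and_self]
  rw [homSol_peak a b hk, mul_div_cancel_right₀ _ (pow_ne_zero 2 (homSol_ne_zero a b _))]

/-! ### Functions with an integrable derivative -/

section IntegrableDeriv

variable {E : Type*} [NormedAddCommGroup E] [NormedSpace ℝ E]

/-- `g` is continuous, it has the continuous derivative `g'` off a countable set, and `g'` is
integrable on bounded intervals. In particular `g` is an integral function of `g'`; singularities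
such as that of the square root at `0` are allowed. -/
structure HasIntegrableDeriv (g g' : ℝ → E) : Prop where
  continuous : Continuous g
  intervalIntegrable : ∀ a b, IntervalIntegrable g' volume a b
  exists_countable : ∃ S : Set ℝ, S.Countable ∧ ∀ t ∉ S, HasDerivAt g (g' t) t ∧ ContinuousAt g' t

namespace HasIntegrableDeriv

variable {g g' : ℝ → E}

lemma integral_eq [CompleteSpace E] (h : HasIntegrableDeriv g g') (a b : ℝ) :
    ∫ s in a..b, g' s = g b - g a := by
  obtain ⟨S, hS, hd⟩ := h.exists_countable
  exact integral_eq_of_hasDerivAt_off_countable g g' hS h.continuous.continuousOn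
    (fun x hx => (hd x hx.2).1) (h.intervalIntegrable a b)

lemma of_hasDerivAt (hd : ∀ t, HasDerivAt g (g' t) t) (hc : Continuous g') :
    HasIntegrableDeriv g g' where
  continuous := continuous_iff_continuousAt.2 fun t => (hd t).continuousAt
  intervalIntegrable a b := hc.intervalIntegrable a b
  exists_countable := ⟨∅, Set.countable_empty, fun t _ => ⟨hd t, hc.continuousAt⟩⟩

lemma smul {f f' : ℝ → ℝ} (hf : HasIntegrableDeriv f f') (hg : HasIntegrableDeriv g g') :
    HasIntegrableDeriv (fun t => f t • g t) (fun t => f t • g' t + f' t • g t) where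
  continuous := hf.continuous.smul hg.continuous
  intervalIntegrable a b :=
    ((hg.intervalIntegrable a b).continuousOn_smul hf.continuous.continuousOn).add
      ((hf.intervalIntegrable a b).smul_continuousOn hg.continuous.continuousOn)
  exists_countable := by
    obtain ⟨S, hS, hdf⟩ := hf.exists_countable
    obtain ⟨T, hT, hdg⟩ := hg.exists_countable
    refine ⟨S ∪ T, hS.union hT, fun t ht => ?_⟩
    have h1 := hdf t fun h => ht (Or.inl h)
    have h2 := hdg t fun h => ht (Or.inr h)
    exact ⟨h1.1.smul h2.1, (hf.continuous.continuousAt.smul h2.2).add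
      (h1.2.smul hg.continuous.continuousAt)⟩

lemma primitive [CompleteSpace E] (hg : HasIntegrableDeriv g g') {w : ℝ → ℝ} (hw : Continuous w) :
    HasIntegrableDeriv (fun t => ∫ s in (0 : ℝ)..t, w s • g' s) (fun t => w t • g' t) := by
  have hi : ∀ a b, IntervalIntegrable (fun t => w t • g' t) volume a b := fun a b =>
    (hg.intervalIntegrable a b).continuousOn_smul hw.continuousOn
  refine ⟨intervalIntegral.continuous_primitive hi 0, hi, ?_⟩
  obtain ⟨S, hS, hd⟩ := hg.exists_countable
  refine ⟨S, hS, fun t ht => ?_⟩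
  have hc : ContinuousAt (fun t => w t • g' t) t := hw.continuousAt.smul (hd t ht).2
  refine ⟨intervalIntegral.integral_hasDerivAt_right (hi 0 t) ?_ hc, hc⟩
  exact ⟨Set.Ioo (t - 1) (t + 1), Ioo_mem_nhds (by linarith) (by linarith),
    ((hi (t - 1) (t + 1)).1.mono_set Set.Ioo_subset_Ioc_self).aestronglyMeasurable⟩

lemma neg (hg : HasIntegrableDeriv g g') :
    HasIntegrableDeriv (fun t => -g t) (fun t => -g' t) where
  continuous := hg.continuous.neg
  intervalIntegrable a b := (hg.intervalIntegrable a b).neg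
  exists_countable := by
    obtain ⟨S, hS, hd⟩ := hg.exists_countable
    exact ⟨S, hS, fun t ht => ⟨(hd t ht).1.neg, (hd t ht).2.neg⟩⟩

lemma add {h h' : ℝ → E} (hg : HasIntegrableDeriv g g') (hh : HasIntegrableDeriv h h') :
    HasIntegrableDeriv (fun t => g t + h t) (fun t => g' t + h' t) where
  continuous := hg.continuous.add hh.continuous
  intervalIntegrable a b := (hg.intervalIntegrable a b).add (hh.intervalIntegrable a b)
  exists_countable := by
    obtain ⟨S, hS, hdg⟩ := hg.exists_countable
    obtain ⟨T, hT, hdh⟩ := hh.exists_countable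
    refine ⟨S ∪ T, hS.union hT, fun t ht => ?_⟩
    have h1 := hdg t fun h => ht (Or.inl h)
    have h2 := hdh t fun h => ht (Or.inr h)
    exact ⟨h1.1.add h2.1, h1.2.add h2.2⟩

lemma smul_const {f f' : ℝ → ℝ} (hf : HasIntegrableDeriv f f') (x : E) :
    HasIntegrableDeriv (fun t => f t • x) (fun t => f' t • x) := by
  have h : HasIntegrableDeriv (fun _ : ℝ => x) fun _ => 0 :=
    of_hasDerivAt (fun t => hasDerivAt_const t x) continuous_const
  simpa using hf.smul h

end HasIntegrableDeriv

end IntegrableDeriv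

/-! ### Wiener integrals -/

section Pathwise

variable {Ω : Type*} {E : Type*} [NormedAddCommGroup E] [NormedSpace ℝ E]

/-- The Wiener integral `∫₀ᵗ g dB`, defined path by path through integration by parts, where `g'`
is the derivative of `g`. -/
def wienerIntegral (B : ℝ → Ω → ℝ) (g g' : ℝ → E) (t : ℝ) (w : Ω) : E :=
  B t w • g t - ∫ s in (0 : ℝ)..t, B s w • g' s

/-- The left-endpoint sum for `∫₀ᵗ g dB`. -/
def leftSum (B : ℝ → Ω → ℝ) (g : ℝ → E) (t : ℝ) (N : ℕ) (w : Ω) : E :=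
  ∑ i ∈ Finset.range N, (B (t * (i + 1) / N) w - B (t * i / N) w) • g (t * i / N)

/-- Summation by parts: the left-endpoint sum differs from the Wiener integral by an integral of
increments of `B` over short intervals. -/
lemma leftSum_sub_wienerIntegral [CompleteSpace E] {B : ℝ → Ω → ℝ} {g g' : ℝ → E}
    (hg : HasIntegrableDeriv g g') {w : Ω} (hc : Continuous fun t => B t w) (h0 : B 0 w = 0)
    (t : ℝ) {N : ℕ} (hN : N ≠ 0) :
    leftSum B g t N w - wienerIntegral B g g' t w =
      ∑ i ∈ Finset.range N, ∫ s in (t * i / N)..(t * (i + 1) / N),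
        (B s w - B (t * (i + 1) / N) w) • g' s := by
  have hN' : (N : ℝ) ≠ 0 := Nat.cast_ne_zero.2 hN
  set p : ℕ → ℝ := fun i => t * i / N with hp
  have hp1 : ∀ i : ℕ, t * (i + 1) / N = p (i + 1) := fun i => by simp [hp]
  have hp0 : p 0 = 0 := by simp [hp]
  have hpN : p N = t := by simp [hp, hN']
  have hterm : ∀ i, ∫ s in (p i)..(p (i + 1)), (B s w - B (p (i + 1)) w) • g' s =
      (∫ s in (p i)..(p (i + 1)), B s w • g' s) - B (p (i + 1)) w • (g (p (i + 1)) - g (p i)) := by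
    intro i
    simp only [sub_smul]
    rw [intervalIntegral.integral_sub
      ((hg.intervalIntegrable _ _).continuousOn_smul hc.continuousOn)
      ((hg.intervalIntegrable _ _).continuousOn_smul continuousOn_const),
      intervalIntegral.integral_smul, hg.integral_eq]
  have hi : ∑ i ∈ Finset.range N, ∫ s in (p i)..(p (i + 1)), B s w • g' s
      = ∫ s in (0 : ℝ)..t, B s w • g' s := by
    rw [intervalIntegral.sum_integral_adjacent_intervals fun k _ =>
      (hg.intervalIntegrable _ _).continuousOn_smul hc.continuousOn, hp0, hpN]
  have htel : ∑ i ∈ Finset.range N, (B (p (i + 1)) w - B (p i) w) • g (p i)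
      = B t w • g t - ∑ i ∈ Finset.range N, B (p (i + 1)) w • (g (p (i + 1)) - g (p i)) := by
    have := Finset.sum_range_sub (fun i => B (p i) w • g (p i)) N
    rw [hp0, hpN, h0, zero_smul, sub_zero] at this
    rw [← this, ← Finset.sum_sub_distrib]
    refine Finset.sum_congr rfl fun i _ => ?_
    rw [smul_sub, sub_smul]; abel
  simp only [leftSum, wienerIntegral, hp1]
  change ∑ i ∈ Finset.range N, (B (p (i + 1)) w - B (p i) w) • g (p i) - _ =
    ∑ i ∈ Finset.range N, ∫ s in (p i)..(p (i + 1)), (B s w - B (p (i + 1)) w) • g' s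
  simp only [hterm, Finset.sum_sub_distrib, hi, htel]
  abel

/-- The integration by parts formula of the Wiener integral is compatible with the product rule:
`φ(t) ∫₀ᵗ h dB` is, path by path, the solution of `dx = r x dt + φ h dB`, `x(0) = 0`, where
`φ' = r φ`. -/
lemma smul_wienerIntegral_eq [CompleteSpace E] {B : ℝ → Ω → ℝ} {φ r : ℝ → ℝ} {h h' : ℝ → E}
    (hφ : HasIntegrableDeriv φ fun t => r t * φ t) (hh : HasIntegrableDeriv h h') {w : Ω}
    (hc : Continuous fun t => B t w) (t : ℝ) :
    φ t • wienerIntegral B h h' t w =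
      (∫ s in (0 : ℝ)..t, r s • φ s • wienerIntegral B h h' s w) +
        wienerIntegral B (fun t => φ t • h t) (fun t => φ t • h' t + (r t * φ t) • h t) t w := by
  -- both sides are compared through the product rule for `φ(t) ∫₀ᵗ B h' ds`
  have hK := hφ.smul (hh.primitive hc)
  have hg := hφ.smul hh
  have h1 := hK.integral_eq 0 t
  simp only [intervalIntegral.integral_same, smul_zero, sub_zero] at h1
  have h2 : ∫ s in (0 : ℝ)..t, r s • φ s • wienerIntegral B h h' s w =
      (∫ s in (0 : ℝ)..t, B s w • (φ s • h' s + (r s * φ s) • h s)) -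
        ∫ s in (0 : ℝ)..t, φ s • B s w • h' s +
          (r s * φ s) • ∫ x in (0 : ℝ)..s, B x w • h' x := by
    rw [← intervalIntegral.integral_sub
      ((hg.intervalIntegrable _ _).continuousOn_smul hc.continuousOn) (hK.intervalIntegrable _ _)]
    refine intervalIntegral.integral_congr fun s _ => ?_
    simp only [wienerIntegral, smul_sub, smul_add, smul_smul]
    rw [mul_comm (B s w) (φ s), show B s w * (r s * φ s) = r s * (φ s * B s w) by ring]
    abel
  rw [h2, h1]
  simp only [wienerIntegral, smul_sub, smul_smul]
  rw [mul_comm (φ t)]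
  abel

end Pathwise

section Wiener

variable {Ω : Type*} [MeasurableSpace Ω]

/-- `B`, indexed by all real times, is a version of the process `W` on `[0, ∞)` all of whose paths
are continuous and start at `0`. -/
structure IsContinuousVersion (P : Measure Ω) (W : ℝ≥0 → Ω → ℝ) (B : ℝ → Ω → ℝ) : Prop where
  measurable : ∀ t, Measurable (B t)
  continuous : ∀ w, Continuous fun t => B t w
  zero : ∀ w, B 0 w = 0
  ae_eq : ∀ᵐ w ∂P, ∀ t : ℝ, B t w = W t.toNNReal w

lemma exists_continuousVersion {P : Measure Ω} {W : ℝ≥0 → Ω → ℝ} (hWm : ∀ t, Measurable (W t))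
    (hW : IsBrownianReal W P) : ∃ B, IsContinuousVersion P W B := by
  -- discard a measurable null set that contains all the irregular paths
  have hgood : ∀ᵐ w ∂P, Continuous (W · w) ∧ W 0 w = 0 := by
    filter_upwards [hW.cont, hW.eval_zero_ae_eq_zero] with w h1 h2 using ⟨h1, h2⟩
  set N := toMeasurable P {w | ¬ (Continuous (W · w) ∧ W 0 w = 0)} with hN
  have hNm : MeasurableSet N := measurableSet_toMeasurable _ _
  have hN0 : P N = 0 := by rw [hN, measure_toMeasurable]; exact hgood
  have hsub : ∀ w ∉ N, Continuous (W · w) ∧ W 0 w = 0 := fun w hw => by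
    by_contra h; exact hw (subset_toMeasurable _ _ h)
  refine ⟨fun t => Nᶜ.indicator (W t.toNNReal), ?_, ?_, ?_, ?_⟩
  · exact fun t => (hWm _).indicator hNm.compl
  · intro w
    by_cases hw : w ∈ N
    · simp only [Set.indicator_of_notMem (Set.notMem_compl_iff.2 hw)]
      exact continuous_const
    · simp only [Set.indicator_of_mem (Set.mem_compl hw)]
      exact (hsub w hw).1.comp continuous_real_toNNReal
  · intro w
    by_cases hw : w ∈ N
    · simp [Set.indicator_of_notMem (Set.notMem_compl_iff.2 hw)]
    · simp [Set.indicator_of_mem (Set.mem_compl hw), (hsub w hw).2]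
  · filter_upwards [measure_eq_zero_iff_ae_notMem.1 hN0] with w hw t
    simp [Set.indicator_of_mem (Set.mem_compl hw)]

section Brownian

variable {P : Measure Ω} {W : ℝ≥0 → Ω → ℝ}

lemma memLp_brownian (hW : IsBrownianReal W P) (t : ℝ≥0) : MemLp (W t) 2 P :=
  (hW.isGaussianProcess.hasGaussianLaw_eval t).memLp_two

lemma IsContinuousVersion.memLp {B : ℝ → Ω → ℝ} (hB : IsContinuousVersion P W B)
    (hW : IsBrownianReal W P) (t : ℝ) : MemLp (B t) 2 P :=
  (memLp_brownian hW t.toNNReal).ae_eq (by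
    filter_upwards [hB.ae_eq] with w hw using (hw t).symm)

lemma IsContinuousVersion.integral_eq_zero {B : ℝ → Ω → ℝ} (hB : IsContinuousVersion P W B)
    (hW : IsBrownianReal W P) (t : ℝ) : ∫ w, B t w ∂P = 0 := by
  rw [← hW.integral_eval t.toNNReal]
  exact integral_congr_ae (by filter_upwards [hB.ae_eq] with w hw using hw t)

lemma IsContinuousVersion.covariance_eq {B : ℝ → Ω → ℝ} (hB : IsContinuousVersion P W B)
    (hW : IsBrownianReal W P) {s t : ℝ} (hs : 0 ≤ s) (ht : 0 ≤ t) :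
    cov[B s, B t; P] = min s t := by
  have h := hW.covariance_eval s.toNNReal t.toNNReal
  rw [NNReal.coe_min, Real.coe_toNNReal _ hs, Real.coe_toNNReal _ ht] at h
  have hs' : B s =ᵐ[P] W s.toNNReal := by filter_upwards [hB.ae_eq] with w hw using hw s
  have ht' : B t =ᵐ[P] W t.toNNReal := by filter_upwards [hB.ae_eq] with w hw using hw t
  rw [← h, covariance, covariance, integral_congr_ae hs', integral_congr_ae ht']
  refine integral_congr_ae ?_
  filter_upwards [hs', ht'] with w h1 h2
  rw [h1, h2]

lemma IsContinuousVersion.covariance_increments [IsProbabilityMeasure P] {B : ℝ → Ω → ℝ}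
    (hB : IsContinuousVersion P W B) (hW : IsBrownianReal W P) {s t s' t' : ℝ}
    (hs : 0 ≤ s) (ht : 0 ≤ t) (hs' : 0 ≤ s') (ht' : 0 ≤ t') :
    cov[fun w => B t w - B s w, fun w => B t' w - B s' w; P]
      = min t t' - min t s' - min s t' + min s s' := by
  rw [covariance_fun_sub_fun_sub (hB.memLp hW _) (hB.memLp hW _) (hB.memLp hW _) (hB.memLp hW _)]
  rw [← hB.covariance_eq hW ht ht', ← hB.covariance_eq hW ht hs', ← hB.covariance_eq hW hs ht',
    ← hB.covariance_eq hW hs hs']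

lemma IsContinuousVersion.lintegral_increment_sq [IsProbabilityMeasure P] {B : ℝ → Ω → ℝ}
    (hB : IsContinuousVersion P W B) (hW : IsBrownianReal W P) {s t : ℝ} (hs : 0 ≤ s) (hst : s ≤ t) :
    ∫⁻ w, ‖B s w - B t w‖ₑ ^ 2 ∂P = ENNReal.ofReal (t - s) := by
  have ht := hs.trans hst
  have hm : MemLp (fun w => B t w - B s w) 2 P := (hB.memLp hW t).sub (hB.memLp hW s)
  have h0 : ∫ w, B t w - B s w ∂P = 0 := by
    rw [integral_sub ((hB.memLp hW t).integrable (by simp)) ((hB.memLp hW s).integrable (by simp)),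
      hB.integral_eq_zero hW, hB.integral_eq_zero hW, sub_zero]
  have hv : ∫ w, (B t w - B s w) ^ 2 ∂P = t - s := by
    rw [← variance_of_integral_eq_zero hm.aemeasurable h0, ← covariance_self hm.aemeasurable,
      hB.covariance_increments hW hs ht hs ht, min_self, min_self, min_eq_right hst,
      min_eq_left hst]
    ring
  rw [← hv, ofReal_integral_eq_lintegral_ofReal hm.integrable_sq
    (ae_of_all _ fun w => sq_nonneg _)]
  refine lintegral_congr fun w => ?_
  rw [← Real.enorm_of_nonneg (sq_nonneg _), enorm_pow, ← enorm_neg, neg_sub]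

end Brownian

/-- The Cauchy-Schwarz inequality for the measure with density `k`. -/
lemma lintegral_mul_sq_le {X : Type*} [MeasurableSpace X] {μ : Measure X} {f k : X → ℝ≥0∞}
    (hf : AEMeasurable f μ) (hk : AEMeasurable k μ) :
    (∫⁻ x, f x * k x ∂μ) ^ 2 ≤ (∫⁻ x, f x ^ 2 * k x ∂μ) * ∫⁻ x, k x ∂μ := by
  have hk2 : AEMeasurable (fun x => k x ^ (1 / 2 : ℝ)) μ := hk.pow_const _
  have hkk : ∀ x, k x ^ (1 / 2 : ℝ) * k x ^ (1 / 2 : ℝ) = k x := fun x => by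
    rw [← ENNReal.rpow_add_of_nonneg _ _ (by norm_num) (by norm_num)]; norm_num
  have h := ENNReal.lintegral_mul_le_Lp_mul_Lq μ Real.HolderConjugate.two_two (hf.mul hk2) hk2
  have h1 : ∀ x, ((fun x => f x * k x ^ (1 / 2 : ℝ)) * fun x => k x ^ (1 / 2 : ℝ)) x
      = f x * k x := fun x => by simp only [Pi.mul_apply]; rw [mul_assoc, hkk]
  have h2 : ∀ x, (f * fun x => k x ^ (1 / 2 : ℝ)) x ^ (2 : ℝ) = f x ^ 2 * k x := fun x => by
    simp only [Pi.mul_apply]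
    rw [ENNReal.rpow_two, mul_pow, sq (k x ^ (1 / 2 : ℝ)), hkk]
  have h3 : ∀ x, (k x ^ (1 / 2 : ℝ)) ^ (2 : ℝ) = k x := fun x => by
    rw [ENNReal.rpow_two, sq, hkk]
  simp only [h2, h3] at h
  have h4 := pow_le_pow_left₀ (by positivity) ((lintegral_congr h1).symm.trans_le h) 2
  have h5 : ∀ x : ℝ≥0∞, (x ^ (1 / 2 : ℝ)) ^ 2 = x := fun x => by
    rw [← ENNReal.rpow_two, ← ENNReal.rpow_mul]; norm_num
  rwa [mul_pow, h5, h5] at h4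

variable {E : Type*} [NormedAddCommGroup E] [NormedSpace ℝ E]
variable {P : Measure Ω} {W : ℝ≥0 → Ω → ℝ} {B : ℝ → Ω → ℝ}

lemma IsContinuousVersion.aestronglyMeasurable_uncurry (hB : IsContinuousVersion P W B)
    (μ : Measure (Ω × ℝ)) : AEStronglyMeasurable (fun p : Ω × ℝ => B p.2 p.1) μ :=
  ((stronglyMeasurable_uncurry_of_continuous_of_stronglyMeasurable hB.continuous
    fun t => (hB.measurable t).stronglyMeasurable).comp_measurable
      measurable_swap).aestronglyMeasurable

lemma aestronglyMeasurable_integral_increment [CompleteSpace E] [IsProbabilityMeasure P]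
    (hB : IsContinuousVersion P W B)
    {g g' : ℝ → E} (hg : HasIntegrableDeriv g g') (a b : ℝ) :
    AEStronglyMeasurable (fun w => ∫ s in a..b, (B s w - B b w) • g' s) P := by
  have : ∀ a' b', AEStronglyMeasurable
      (fun w => ∫ s in Set.Ioc a' b', (B s w - B b w) • g' s) P := by
    intro a' b'
    refine AEStronglyMeasurable.integral_prod_right' (μ := P)
      (f := fun p : Ω × ℝ => (B p.2 p.1 - B b p.1) • g' p.2) ?_
    refine AEStronglyMeasurable.smul ((hB.aestronglyMeasurable_uncurry _).sub ?_) ?_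
    · exact ((hB.measurable b).comp measurable_fst).aestronglyMeasurable
    · exact (hg.intervalIntegrable a' b').1.aestronglyMeasurable.comp_snd
  exact (this a b).sub (this b a)

/-- The `L²` norm of a pathwise integral of increments, by the Cauchy-Schwarz inequality and
Tonelli's theorem. -/
lemma eLpNorm_integral_increment_le [CompleteSpace E] [IsProbabilityMeasure P]
    (hB : IsContinuousVersion P W B)
    (hW : IsBrownianReal W P) {g g' : ℝ → E} (hg : HasIntegrableDeriv g g') {a b : ℝ}
    (ha : 0 ≤ a) (hab : a ≤ b) :
    eLpNorm (fun w => ∫ s in a..b, (B s w - B b w) • g' s) 2 P ≤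
      ENNReal.ofReal (√(b - a)) * ∫⁻ s in Set.Ioc a b, ‖g' s‖ₑ := by
  set K := ∫⁻ s in Set.Ioc a b, ‖g' s‖ₑ
  have hgm : AEStronglyMeasurable g' (volume.restrict (Set.Ioc a b)) :=
    (hg.intervalIntegrable a b).1.aestronglyMeasurable
  have hpt : ∀ w, ‖∫ s in a..b, (B s w - B b w) • g' s‖ₑ ^ 2 ≤
      (∫⁻ s in Set.Ioc a b, ‖B s w - B b w‖ₑ ^ 2 * ‖g' s‖ₑ) * K := by
    intro w
    refine le_trans (pow_le_pow_left₀ (by positivity) ?_ 2)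
      (lintegral_mul_sq_le (f := fun s => ‖B s w - B b w‖ₑ) ?_ hgm.enorm)
    · rw [intervalIntegral.integral_of_le hab]
      refine (enorm_integral_le_lintegral_enorm _).trans_eq (lintegral_congr fun s => ?_)
      rw [enorm_smul]
    · exact ((hB.continuous w).sub continuous_const).enorm.measurable.aemeasurable
  have hjoint : AEMeasurable (fun p : Ω × ℝ => ‖B p.2 p.1 - B b p.1‖ₑ ^ 2 * ‖g' p.2‖ₑ)
      (P.prod (volume.restrict (Set.Ioc a b))) :=
    (((hB.aestronglyMeasurable_uncurry _).sub
      ((hB.measurable b).comp measurable_fst).aestronglyMeasurable).enorm.pow_const 2).mul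
      hgm.comp_snd.enorm
  have hsq : ∫⁻ w, ‖∫ s in a..b, (B s w - B b w) • g' s‖ₑ ^ 2 ∂P
      ≤ (ENNReal.ofReal (√(b - a)) * K) ^ 2 := by
    calc _ ≤ ∫⁻ w, (∫⁻ s in Set.Ioc a b, ‖B s w - B b w‖ₑ ^ 2 * ‖g' s‖ₑ) * K ∂P :=
          lintegral_mono hpt
      _ = (∫⁻ w, ∫⁻ s in Set.Ioc a b, ‖B s w - B b w‖ₑ ^ 2 * ‖g' s‖ₑ ∂volume ∂P) * K := by
          exact lintegral_mul_const'' _ hjoint.lintegral_prod_right'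
      _ = (∫⁻ s in Set.Ioc a b, ∫⁻ w, ‖B s w - B b w‖ₑ ^ 2 * ‖g' s‖ₑ ∂P) * K := by
          rw [lintegral_lintegral_swap hjoint]
      _ ≤ (∫⁻ s in Set.Ioc a b, ENNReal.ofReal (b - a) * ‖g' s‖ₑ) * K := by
          gcongr ?_ * _
          refine setLIntegral_mono' measurableSet_Ioc fun s hs => ?_
          have hm : Measurable fun w => ‖B s w - B b w‖ₑ ^ 2 :=
            ((hB.measurable s).sub (hB.measurable b)).enorm.pow_const 2
          rw [lintegral_mul_const _ hm, hB.lintegral_increment_sq hW (ha.trans hs.1.le) hs.2]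
          gcongr
          exact hs.1.le
      _ = (ENNReal.ofReal (√(b - a)) * K) ^ 2 := by
          rw [lintegral_const_mul'' _ hgm.enorm, mul_pow, ← ENNReal.ofReal_pow (Real.sqrt_nonneg _),
            Real.sq_sqrt (sub_nonneg.2 hab), sq, mul_assoc]
  have h2 : eLpNorm (fun w => ∫ s in a..b, (B s w - B b w) • g' s) 2 P ^ 2
      = ∫⁻ w, ‖∫ s in a..b, (B s w - B b w) • g' s‖ₑ ^ 2 ∂P := by
    simpa using eLpNorm_nnreal_pow_eq_lintegral (μ := P) (p := 2)
      (f := fun w => ∫ s in a..b, (B s w - B b w) • g' s) two_ne_zero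
  rw [← h2] at hsq
  exact (ENNReal.pow_le_pow_left_iff two_ne_zero).1 hsq

lemma aestronglyMeasurable_leftSum (hB : IsContinuousVersion P W B) (g : ℝ → E) (t : ℝ) (N : ℕ) :
    AEStronglyMeasurable (leftSum B g t N) P :=
  Finset.aestronglyMeasurable_fun_sum _ fun _ _ =>
    ((hB.measurable _).sub (hB.measurable _)).aestronglyMeasurable.smul_const _

lemma memLp_leftSum (hB : IsContinuousVersion P W B) (hW : IsBrownianReal W P) (g : ℝ → E) (t : ℝ)
    (N : ℕ) : MemLp (leftSum B g t N) 2 P :=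
  memLp_finsetSum _ fun i _ => by
    have h : MemLp (fun w => B (t * (i + 1) / N) w - B (t * i / N) w) 2 P :=
      (hB.memLp hW _).sub (hB.memLp hW _)
    exact (ContinuousLinearMap.toSpanSingleton ℝ (g (t * i / N))).comp_memLp' h

lemma eLpNorm_leftSum_sub_wienerIntegral_le [CompleteSpace E] [IsProbabilityMeasure P]
    (hB : IsContinuousVersion P W B) (hW : IsBrownianReal W P) {g g' : ℝ → E}
    (hg : HasIntegrableDeriv g g') {t : ℝ} (ht : 0 ≤ t) {N : ℕ} (hN : N ≠ 0) :
    eLpNorm (leftSum B g t N - wienerIntegral B g g' t) 2 P ≤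
      ENNReal.ofReal (√(t / N)) * ∫⁻ s in Set.Ioc 0 t, ‖g' s‖ₑ := by
  have hN' : (N : ℝ) ≠ 0 := Nat.cast_ne_zero.2 hN
  have heq : leftSum B g t N - wienerIntegral B g g' t =
      ∑ i ∈ Finset.range N, fun w => ∫ s in (t * i / N)..(t * (i + 1) / N),
        (B s w - B (t * (i + 1) / N) w) • g' s := by
    ext w
    rw [Pi.sub_apply, leftSum_sub_wienerIntegral hg (hB.continuous w) (hB.zero w) t hN,
      Finset.sum_apply]
  rw [heq]
  refine (eLpNorm_sum_le (fun i _ => aestronglyMeasurable_integral_increment hB hg _ _)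
    (by norm_num)).trans ?_
  have hle : ∀ i : ℕ, t * i / N ≤ t * (i + 1) / N := fun i => by gcongr; linarith
  have hsum : ∀ n : ℕ, ∑ i ∈ Finset.range n,
      ∫⁻ s in Set.Ioc (t * i / N) (t * (i + 1) / N), ‖g' s‖ₑ
      = ∫⁻ s in Set.Ioc 0 (t * n / N), ‖g' s‖ₑ := by
    intro n
    induction n with
    | zero => simp
    | succ n ih =>
      rw [Finset.sum_range_succ, ih, ← lintegral_union measurableSet_Ioc
        (Set.Ioc_disjoint_Ioc_of_le le_rfl), Set.Ioc_union_Ioc_eq_Ioc (by positivity) (hle n)]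
      push_cast; rfl
  calc _ ≤ ∑ i ∈ Finset.range N, ENNReal.ofReal (√(t / N)) *
        ∫⁻ s in Set.Ioc (t * i / N) (t * (i + 1) / N), ‖g' s‖ₑ := by
        refine Finset.sum_le_sum fun i _ => ?_
        refine (eLpNorm_integral_increment_le hB hW hg (by positivity) (hle i)).trans_eq ?_
        rw [show t * (i + 1) / N - t * i / N = t / N by ring]
    _ = _ := by
        rw [← Finset.mul_sum, hsum N, mul_div_cancel_right₀ _ hN']

lemma aestronglyMeasurable_wienerIntegral [CompleteSpace E] [IsProbabilityMeasure P]
    (hB : IsContinuousVersion P W B) {g g' : ℝ → E} (hg : HasIntegrableDeriv g g') (t : ℝ) :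
    AEStronglyMeasurable (wienerIntegral B g g' t) P := by
  have heq : wienerIntegral B g g' t = leftSum B g t 1 - fun w =>
      ∑ i ∈ Finset.range 1, ∫ s in (t * i / (1 : ℕ))..(t * (i + 1) / (1 : ℕ)),
        (B s w - B (t * (i + 1) / (1 : ℕ)) w) • g' s := by
    ext w
    have := leftSum_sub_wienerIntegral hg (hB.continuous w) (hB.zero w) t one_ne_zero
    rw [Pi.sub_apply, ← this, sub_sub_cancel]
  rw [heq]
  exact (aestronglyMeasurable_leftSum hB g t 1).sub (Finset.aestronglyMeasurable_fun_sum _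
    fun i _ => aestronglyMeasurable_integral_increment hB hg _ _)

lemma lintegral_enorm_deriv_lt_top {g g' : ℝ → E} (hg : HasIntegrableDeriv g g') (t : ℝ) :
    ∫⁻ s in Set.Ioc 0 t, ‖g' s‖ₑ < ∞ :=
  (hg.intervalIntegrable 0 t).1.2

lemma memLp_wienerIntegral [CompleteSpace E] [IsProbabilityMeasure P]
    (hB : IsContinuousVersion P W B) (hW : IsBrownianReal W P) {g g' : ℝ → E}
    (hg : HasIntegrableDeriv g g') {t : ℝ} (ht : 0 ≤ t) :
    MemLp (wienerIntegral B g g' t) 2 P := by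
  have h : MemLp (leftSum B g t 1 - wienerIntegral B g g' t) 2 P :=
    ⟨(aestronglyMeasurable_leftSum hB g t 1).sub (aestronglyMeasurable_wienerIntegral hB hg t),
      (eLpNorm_leftSum_sub_wienerIntegral_le hB hW hg ht one_ne_zero).trans_lt
        (ENNReal.mul_lt_top ENNReal.ofReal_lt_top (lintegral_enorm_deriv_lt_top hg t))⟩
  simpa using (memLp_leftSum hB hW g t 1).sub h

/-- The left-endpoint sums converge to the Wiener integral in mean square. -/
lemma tendsto_leftSum [CompleteSpace E] [IsProbabilityMeasure P]
    (hB : IsContinuousVersion P W B) (hW : IsBrownianReal W P) {g g' : ℝ → E}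
    (hg : HasIntegrableDeriv g g') {t : ℝ} (ht : 0 ≤ t) :
    Tendsto (fun N => eLpNorm (leftSum B g t N - wienerIntegral B g g' t) 2 P) atTop (𝓝 0) := by
  have hlim : Tendsto (fun N : ℕ => ENNReal.ofReal (√(t / N)) * ∫⁻ s in Set.Ioc 0 t, ‖g' s‖ₑ)
      atTop (𝓝 0) := by
    have h1 : Tendsto (fun N : ℕ => ENNReal.ofReal (√(t / N))) atTop (𝓝 0) := by
      rw [← ENNReal.ofReal_zero, ← Real.sqrt_zero]
      exact ENNReal.tendsto_ofReal ((Real.continuous_sqrt.tendsto 0).comp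
        (tendsto_const_div_atTop_nhds_zero_nat t))
    simpa using ENNReal.Tendsto.mul_const h1 (Or.inr (lintegral_enorm_deriv_lt_top hg t).ne)
  refine tendsto_of_tendsto_of_tendsto_of_le_of_le' tendsto_const_nhds hlim
    (Eventually.of_forall fun _ => zero_le) ?_
  filter_upwards [eventually_ne_atTop 0] with N hN
  exact eLpNorm_leftSum_sub_wienerIntegral_le hB hW hg ht hN

/-! ### The second moment of a Wiener integral -/

lemma tendsto_leftRiemannSum {f : ℝ → ℝ} (hf : Continuous f) {t : ℝ} (ht : 0 ≤ t) :
    Tendsto (fun N : ℕ => ∑ i ∈ Finset.range N, t / N * f (t * i / N)) atTop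
      (𝓝 (∫ s in (0 : ℝ)..t, f s)) := by
  rw [Metric.tendsto_atTop]
  intro ε hε
  have huc := isCompact_Icc.uniformContinuousOn_of_continuous (hf.continuousOn (s := Set.Icc 0 t))
  obtain ⟨δ, hδ, hfδ⟩ := Metric.uniformContinuousOn_iff_le.1 huc (ε / (t + 1)) (by positivity)
  obtain ⟨N₀, hN₀⟩ := exists_nat_gt (t / δ)
  refine ⟨N₀ + 1, fun N hN => ?_⟩
  have hNpos : (0 : ℝ) < N := by exact_mod_cast (Nat.succ_pos _).trans_le hN
  have hNδ : t / N ≤ δ := by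
    rw [div_le_iff₀ hNpos, mul_comm, ← div_le_iff₀ hδ]
    exact hN₀.le.trans (by exact_mod_cast (Nat.le_succ _).trans hN)
  set p : ℕ → ℝ := fun i => t * i / N with hp
  have hle : ∀ i, p i ≤ p (i + 1) := fun i => by simp only [hp]; gcongr; simp
  have hstep : ∀ i, p (i + 1) - p i = t / N := fun i => by simp only [hp]; push_cast; ring
  have hI : ∫ s in (0 : ℝ)..t, f s = ∑ i ∈ Finset.range N, ∫ s in (p i)..(p (i + 1)), f s := by
    rw [intervalIntegral.sum_integral_adjacent_intervals fun k _ => hf.intervalIntegrable _ _]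
    simp [hp, hNpos.ne']
  rw [dist_comm, Real.dist_eq, hI, ← Finset.sum_sub_distrib]
  have hterm : ∀ i ∈ Finset.range N,
      |(∫ s in (p i)..(p (i + 1)), f s) - t / N * f (p i)| ≤ ε / (t + 1) * (t / N) := by
    intro i hi
    have hpi : 0 ≤ p i := by simp only [hp]; positivity
    have hpi1 : p (i + 1) ≤ t := by
      simp only [hp]
      rw [div_le_iff₀ hNpos]
      gcongr
      exact_mod_cast Finset.mem_range.1 hi
    have h1 : (∫ s in (p i)..(p (i + 1)), f s) - t / N * f (p i)
        = ∫ s in (p i)..(p (i + 1)), (f s - f (p i)) := by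
      rw [intervalIntegral.integral_sub (hf.intervalIntegrable _ _) (by simp),
        intervalIntegral.integral_const, hstep, smul_eq_mul]
    rw [h1, ← Real.norm_eq_abs, ← hstep i, ← abs_of_nonneg (sub_nonneg.2 (hle i))]
    refine intervalIntegral.norm_integral_le_of_norm_le_const fun s hs => ?_
    rw [Set.uIoc_of_le (hle i)] at hs
    refine hfδ s ⟨hpi.trans hs.1.le, hs.2.trans hpi1⟩ (p i) ⟨hpi, (hle i).trans hpi1⟩ ?_
    rw [Real.dist_eq, abs_of_nonneg (sub_nonneg.2 hs.1.le)]
    linarith [hs.2, hstep i]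
  calc _ ≤ ∑ i ∈ Finset.range N, ε / (t + 1) * (t / N) :=
        (Finset.abs_sum_le_sum_abs _ _).trans (Finset.sum_le_sum hterm)
    _ = ε * (t / (t + 1)) := by
        rw [Finset.sum_const, Finset.card_range, nsmul_eq_mul]; field_simp
    _ < ε := by
        refine mul_lt_of_lt_one_right hε ?_
        rw [div_lt_one (by linarith)]; linarith

/-- The second moment of a constant plus a linear combination of Brownian increments. -/
lemma integral_const_add_sum_increments_sq [IsProbabilityMeasure P]
    (hB : IsContinuousVersion P W B) (hW : IsBrownianReal W P) {t : ℝ} (ht : 0 ≤ t) (N : ℕ)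
    (x : ℕ → ℝ) (c : ℝ) :
    ∫ w, (c + ∑ i ∈ Finset.range N, x i * (B (t * (i + 1) / N) w - B (t * i / N) w)) ^ 2 ∂P
      = c ^ 2 + ∑ i ∈ Finset.range N, t / N * x i ^ 2 := by
  set X : ℕ → Ω → ℝ := fun i w => x i * (B (t * (i + 1) / N) w - B (t * i / N) w) with hX
  have hinc : ∀ i : ℕ, MemLp (fun w => B (t * (i + 1) / N) w - B (t * i / N) w) 2 P := fun i =>
    (hB.memLp hW _).sub (hB.memLp hW _)
  have hXm : ∀ i, MemLp (X i) 2 P := fun i => (hinc i).const_mul (x i)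
  have hX0 : ∀ i, ∫ w, X i w ∂P = 0 := fun i => by
    simp only [hX]
    rw [integral_const_mul, integral_sub ((hB.memLp hW _).integrable (by simp))
      ((hB.memLp hW _).integrable (by simp)), hB.integral_eq_zero hW, hB.integral_eq_zero hW]
    simp
  set S : Ω → ℝ := ∑ i ∈ Finset.range N, X i with hS
  have hSm : MemLp S 2 P := memLp_finsetSum' _ fun i _ => hXm i
  have hS0 : ∫ w, S w ∂P = 0 := by
    simp only [hS, Finset.sum_apply]
    rw [integral_finsetSum _ fun i _ => (hXm i).integrable (by simp)]
    exact Finset.sum_eq_zero fun i _ => hX0 i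
  have hcov : ∀ i ∈ Finset.range N, ∑ j ∈ Finset.range N, cov[X i, X j; P] = t / N * x i ^ 2 := by
    intro i hi
    have hpos : ∀ j : ℕ, 0 ≤ t * (j + 1) / N := fun j => by positivity
    have hpos' : ∀ j : ℕ, 0 ≤ t * j / N := fun j => by positivity
    have hmono : ∀ {j k : ℝ}, j ≤ k → t * j / N ≤ t * k / N := fun h => by gcongr
    have hij : ∀ j, cov[X i, X j; P] = x i * (x j * (min (t * (i + 1) / N) (t * (j + 1) / N)
        - min (t * (i + 1) / N) (t * j / N) - min (t * i / N) (t * (j + 1) / N)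
        + min (t * i / N) (t * j / N))) := fun j => by
      simp only [hX]
      rw [covariance_const_mul_left, covariance_const_mul_right,
        hB.covariance_increments hW (hpos' i) (hpos i) (hpos' j) (hpos j)]
    rw [Finset.sum_eq_single_of_mem i hi, hij]
    · have h1 : t * i / N ≤ t * (i + 1) / N := hmono (by linarith)
      rw [min_self, min_self, min_eq_right h1, min_eq_left h1]; ring
    · intro j _ hj
      rw [hij]
      rcases lt_or_gt_of_ne hj with h | h
      · have h' : (j : ℝ) + 1 ≤ i := by exact_mod_cast h
        rw [min_eq_right (hmono (by linarith)), min_eq_right (hmono (by linarith)),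
          min_eq_right (hmono h'), min_eq_right (hmono (by linarith))]
        ring
      · have h' : (i : ℝ) + 1 ≤ j := by exact_mod_cast h
        rw [min_eq_left (hmono (by linarith)), min_eq_left (hmono h'),
          min_eq_left (hmono (by linarith)), min_eq_left (hmono (by linarith))]
        ring
  have hvar : ∫ w, S w ^ 2 ∂P = ∑ i ∈ Finset.range N, t / N * x i ^ 2 := by
    rw [← variance_of_integral_eq_zero hSm.aemeasurable hS0, hS, variance_sum' fun i _ => hXm i]
    exact Finset.sum_congr rfl hcov
  have hexp : ∀ w, (c + ∑ i ∈ Finset.range N, X i w) ^ 2 = c ^ 2 + (2 * c * S w + S w ^ 2) := by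
    intro w; simp only [hS, Finset.sum_apply]; ring
  have hSi : Integrable (fun w => 2 * c * S w) P := (hSm.integrable (by simp)).const_mul _
  have hSi2 : Integrable (fun w => S w ^ 2) P := hSm.integrable_sq
  change ∫ w, (c + ∑ i ∈ Finset.range N, X i w) ^ 2 ∂P = _
  simp only [hexp]
  have hSi3 : Integrable (fun w => 2 * c * S w + S w ^ 2) P := hSi.add hSi2
  rw [integral_add (integrable_const _) hSi3, integral_add hSi hSi2,
    integral_const_mul, hS0, hvar]
  simp

variable {𝕜 : Type*} [RCLike 𝕜]

lemma integral_norm_one_add_leftSum_sq [IsProbabilityMeasure P] (hB : IsContinuousVersion P W B)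
    (hW : IsBrownianReal W P) (h : ℝ → 𝕜) {t : ℝ} (ht : 0 ≤ t) (N : ℕ) :
    ∫ w, ‖1 + leftSum B h t N w‖ ^ 2 ∂P
      = 1 + ∑ i ∈ Finset.range N, t / N * ‖h (t * i / N)‖ ^ 2 := by
  have hw : ∀ w, ‖1 + leftSum B h t N w‖ ^ 2 =
      (1 + ∑ i ∈ Finset.range N, RCLike.re (h (t * i / N)) *
        (B (t * (i + 1) / N) w - B (t * i / N) w)) ^ 2 +
      (0 + ∑ i ∈ Finset.range N, RCLike.im (h (t * i / N)) *
        (B (t * (i + 1) / N) w - B (t * i / N) w)) ^ 2 := by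
    intro w
    rw [← RCLike.normSq_eq_def', RCLike.normSq_apply]
    simp only [leftSum, map_add, map_sum, RCLike.one_re, RCLike.one_im, RCLike.smul_re,
      RCLike.smul_im, ← sq]
    simp only [mul_comm]
  have hint : ∀ (x : ℕ → ℝ) (c : ℝ), Integrable (fun w => (c + ∑ i ∈ Finset.range N, x i *
      (B (t * (i + 1) / N) w - B (t * i / N) w)) ^ 2) P := fun x c =>
    ((memLp_const c).add (memLp_finsetSum _ fun i _ =>
      ((hB.memLp hW _).sub (hB.memLp hW _)).const_mul (x i))).integrable_sq
  simp only [hw]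
  rw [integral_add (hint _ _) (hint _ _), integral_const_add_sum_increments_sq hB hW ht,
    integral_const_add_sum_increments_sq hB hW ht, one_pow, zero_pow two_ne_zero, zero_add,
    add_assoc, ← Finset.sum_add_distrib]
  congr 1
  refine Finset.sum_congr rfl fun i _ => ?_
  rw [← mul_add, ← RCLike.normSq_eq_def', RCLike.normSq_apply, sq, sq]

lemma tendsto_integral_norm_sq [IsProbabilityMeasure P] {f : ℕ → Ω → 𝕜} {g : Ω → 𝕜}
    (hf : ∀ n, MemLp (f n) 2 P) (hg : MemLp g 2 P)
    (h : Tendsto (fun n => eLpNorm (f n - g) 2 P) atTop (𝓝 0)) :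
    Tendsto (fun n => ∫ w, ‖f n w‖ ^ 2 ∂P) atTop (𝓝 (∫ w, ‖g w‖ ^ 2 ∂P)) := by
  have h1 := ((Lp.tendsto_Lp_iff_tendsto_eLpNorm'' f hf g hg).2 h).norm.pow 2
  have h2 : ∀ {f : Ω → 𝕜} (hf : MemLp f 2 P), ‖hf.toLp f‖ ^ 2 = ∫ w, ‖f w‖ ^ 2 ∂P := by
    intro f hf
    rw [← @inner_self_eq_norm_sq 𝕜, L2.inner_def, ← integral_re (L2.integrable_inner _ _)]
    refine integral_congr_ae ?_
    filter_upwards [hf.coeFn_toLp] with w hw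
    rw [hw, inner_self_eq_norm_sq]
  simpa only [h2] using h1

/-- The Itô isometry for `1 + ∫₀ᵗ h dB`. -/
lemma integral_norm_one_add_wienerIntegral_sq [IsProbabilityMeasure P]
    (hB : IsContinuousVersion P W B) (hW : IsBrownianReal W P) {h h' : ℝ → 𝕜}
    (hh : HasIntegrableDeriv h h') {t : ℝ} (ht : 0 ≤ t) :
    ∫ w, ‖1 + wienerIntegral B h h' t w‖ ^ 2 ∂P = 1 + ∫ s in (0 : ℝ)..t, ‖h s‖ ^ 2 := by
  have hone : MemLp (fun _ : Ω => (1 : 𝕜)) 2 P := memLp_const 1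
  have h1 := tendsto_integral_norm_sq (P := P) (f := fun N w => 1 + leftSum B h t N w)
    (g := fun w => 1 + wienerIntegral B h h' t w)
    (fun N => hone.add (memLp_leftSum hB hW h t N))
    (hone.add (memLp_wienerIntegral hB hW hh ht)) (by
      refine (tendsto_leftSum hB hW hh ht).congr fun N => ?_
      congr 1
      ext w
      simp)
  simp only [integral_norm_one_add_leftSum_sq hB hW h ht] at h1
  exact tendsto_nhds_unique h1 ((tendsto_leftRiemannSum (hh.continuous.norm.pow 2) ht).const_add 1)

end Wiener

/-! ### The square root of the cosine -/

/-- The derivative of `√(q cos t)`. It vanishes where `q cos t ≤ 0`, by the conventions for the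
square root and for division by zero; this is the right value where `q cos t < 0`. -/
def sqrtCosDeriv (q t : ℝ) : ℝ := -(q * Real.sin t) / (2 * √(q * Real.cos t))

lemma hasDerivAt_sqrt_cos {q t : ℝ} (h : q * Real.cos t ≠ 0) :
    HasDerivAt (fun t => √(q * Real.cos t)) (sqrtCosDeriv q t) t := by
  have := ((Real.hasDerivAt_cos t).const_mul q).sqrt h
  rwa [mul_neg] at this

lemma continuousAt_sqrtCosDeriv {q t : ℝ} (h : q * Real.cos t ≠ 0) :
    ContinuousAt (sqrtCosDeriv q) t := by
  have hc : Continuous fun t => q * Real.cos t := by fun_prop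
  rcases lt_or_gt_of_ne h with h | h
  · have : sqrtCosDeriv q =ᶠ[𝓝 t] fun _ => 0 := by
      filter_upwards [hc.continuousAt.eventually_lt continuousAt_const h] with s hs
      simp [sqrtCosDeriv, Real.sqrt_eq_zero_of_nonpos hs.le]
    exact continuousAt_const.congr this.symm
  · refine ContinuousAt.div (by fun_prop) (by fun_prop) ?_
    have := Real.sqrt_pos.2 h
    positivity

lemma measurable_sqrtCosDeriv (q : ℝ) : Measurable (sqrtCosDeriv q) := by
  unfold sqrtCosDeriv; fun_prop

/-- On an interval without zeros of the cosine on which the sine does not change sign, the function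
`√(q cos t)` is monotone, hence its derivative is integrable. -/
lemma integrableOn_sqrtCosDeriv {q x l r : ℝ} (hq : q ≠ 0) (hx : Real.sin x ≠ 0)
    (hcos : ∀ y ∈ Set.Ioo l r, Real.cos y ≠ 0)
    (hsin : ∀ y ∈ Set.Ioo l r, 0 ≤ Real.sin x * Real.sin y) :
    IntegrableOn (sqrtCosDeriv q) (Set.Ioc l r) := by
  have h : IntegrableOn (fun t => -(q * Real.sin x) * sqrtCosDeriv q t) (Set.Ioc l r) := by
    refine intervalIntegral.integrableOn_deriv_of_nonneg
      (g := fun t => -(q * Real.sin x) * √(q * Real.cos t)) (by fun_prop) ?_ ?_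
    · exact fun y hy => (hasDerivAt_sqrt_cos (mul_ne_zero hq (hcos y hy))).const_mul _
    · intro y hy
      have : -(q * Real.sin x) * sqrtCosDeriv q y =
          q ^ 2 * (Real.sin x * Real.sin y) / (2 * √(q * Real.cos y)) := by
        rw [sqrtCosDeriv]; ring
      rw [this]
      have := hsin y hy
      positivity
  have h0 : -(q * Real.sin x) ≠ 0 := neg_ne_zero.2 (mul_ne_zero hq hx)
  refine (h.const_mul (-(q * Real.sin x))⁻¹).congr (ae_of_all _ fun t => ?_)
  simp only
  rw [inv_mul_cancel_left₀ h0]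

lemma locallyIntegrable_sqrtCosDeriv {q : ℝ} (hq : q ≠ 0) :
    LocallyIntegrable (sqrtCosDeriv q) := by
  intro x
  by_cases hx : Real.cos x = 0
  -- near a zero `x` of the cosine the two sides of `x` are treated separately
  · have hs : Real.sin x ≠ 0 := fun h => by
      have := Real.sin_sq_add_cos_sq x
      simp [h, hx] at this
    have hpos : ∀ u ∈ Set.Ioo (0 : ℝ) 1, 0 < Real.sin u ∧ 0 < Real.cos u := fun u hu =>
      ⟨Real.sin_pos_of_pos_of_lt_pi hu.1 (by linarith [hu.2, Real.pi_gt_three]),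
        Real.cos_pos_of_mem_Ioo ⟨by linarith [hu.1, Real.pi_gt_three],
          by linarith [hu.2, Real.pi_gt_three]⟩⟩
    refine ⟨Set.Ioc (x - 1) (x + 1), Ioc_mem_nhds (by linarith) (by linarith), ?_⟩
    rw [← Set.Ioc_union_Ioc_eq_Ioc (b := x) (by linarith) (by linarith)]
    refine IntegrableOn.union ?_ ?_
    · have hy : ∀ y ∈ Set.Ioo (x - 1) x, Real.cos y = Real.sin x * Real.sin (x - y) ∧
          Real.sin y = Real.sin x * Real.cos (x - y) ∧ x - y ∈ Set.Ioo (0 : ℝ) 1 := fun y hy => by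
        refine ⟨?_, ?_, by linarith [hy.2], by linarith [hy.1]⟩
        · conv_lhs => rw [← sub_sub_cancel x y, Real.cos_sub, hx]
          ring
        · conv_lhs => rw [← sub_sub_cancel x y, Real.sin_sub, hx]
          ring
      refine integrableOn_sqrtCosDeriv hq hs (fun y hy' => ?_) (fun y hy' => ?_)
      · obtain ⟨h1, -, h3⟩ := hy y hy'
        rw [h1]; exact mul_ne_zero hs (hpos _ h3).1.ne'
      · obtain ⟨-, h2, h3⟩ := hy y hy'
        rw [h2, ← mul_assoc]; exact mul_nonneg (mul_self_nonneg _) (hpos _ h3).2.le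
    · have hy : ∀ y ∈ Set.Ioo x (x + 1), Real.cos y = -(Real.sin x * Real.sin (y - x)) ∧
          Real.sin y = Real.sin x * Real.cos (y - x) ∧ y - x ∈ Set.Ioo (0 : ℝ) 1 := fun y hy => by
        refine ⟨?_, ?_, by linarith [hy.1], by linarith [hy.2]⟩
        · conv_lhs => rw [← add_sub_cancel x y, Real.cos_add, hx]
          ring
        · conv_lhs => rw [← add_sub_cancel x y, Real.sin_add, hx]
          ring
      refine integrableOn_sqrtCosDeriv hq hs (fun y hy' => ?_) (fun y hy' => ?_)
      · obtain ⟨h1, -, h3⟩ := hy y hy'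
        rw [h1]; exact neg_ne_zero.2 (mul_ne_zero hs (hpos _ h3).1.ne')
      · obtain ⟨-, h2, h3⟩ := hy y hy'
        rw [h2, ← mul_assoc]; exact mul_nonneg (mul_self_nonneg _) (hpos _ h3).2.le
  · exact (continuousAt_sqrtCosDeriv (mul_ne_zero hq hx)).integrableAtFilter
      (measurable_sqrtCosDeriv q).stronglyMeasurable.stronglyMeasurableAtFilter
      (Measure.finiteAt_nhds _ _)

lemma countable_setOf_cos_eq_zero : {t : ℝ | Real.cos t = 0}.Countable := by
  refine (Set.countable_range fun k : ℤ => (2 * k + 1) * Real.pi / 2).mono fun t ht => ?_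
  obtain ⟨k, hk⟩ := Real.cos_eq_zero_iff.1 ht
  exact ⟨k, hk.symm⟩

lemma hasIntegrableDeriv_sqrt_cos {q : ℝ} (hq : q ≠ 0) :
    HasIntegrableDeriv (fun t => √(q * Real.cos t)) (sqrtCosDeriv q) where
  continuous := by fun_prop
  intervalIntegrable a b :=
    ⟨(locallyIntegrable_sqrtCosDeriv hq).integrableOn_isCompact isCompact_Icc |>.mono_set
      Set.Ioc_subset_Icc_self, (locallyIntegrable_sqrtCosDeriv hq).integrableOn_isCompact
      isCompact_Icc |>.mono_set Set.Ioc_subset_Icc_self⟩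
  exists_countable := ⟨_, countable_setOf_cos_eq_zero, fun t ht =>
    ⟨hasDerivAt_sqrt_cos (mul_ne_zero hq ht), continuousAt_sqrtCosDeriv (mul_ne_zero hq ht)⟩⟩

section Noise

variable {𝕜 : Type*} [RCLike 𝕜]

/-- The noise coefficients of the system divided by the solutions of the homogeneous equations,
up to sign: `e^{σ sin t} √(2 b cos t)`, with `σ = b` for the first and `σ = -b` for the second
equation. -/
def reducedNoise (σ b : ℝ) (c : 𝕜) (t : ℝ) : 𝕜 :=
  Real.exp (σ * Real.sin t) • sqrtWith c (2 * b * Real.cos t)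

lemma exists_hasIntegrableDeriv_reducedNoise (σ : ℝ) {b : ℝ} (hb : 0 < b) (c : 𝕜) :
    ∃ h', HasIntegrableDeriv (reducedNoise σ b c) h' := by
  have h1 := hasIntegrableDeriv_sqrt_cos (q := 2 * b) (by positivity)
  have h2 := hasIntegrableDeriv_sqrt_cos (q := -(2 * b)) (by simp [hb.ne'])
  have h3 : HasIntegrableDeriv (fun t => Real.exp (σ * Real.sin t)) _ :=
    .of_hasDerivAt (fun t => ((Real.hasDerivAt_sin t).const_mul σ).exp) (by fun_prop)
  have h4 := h3.smul ((h1.smul_const (1 : 𝕜)).add (h2.smul_const c))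
  have heq : reducedNoise σ b c = fun t => Real.exp (σ * Real.sin t) •
      (√(2 * b * Real.cos t) • (1 : 𝕜) + √(-(2 * b) * Real.cos t) • c) := by
    ext t
    simp only [reducedNoise, sqrtWith, RCLike.real_smul_eq_coe_mul, neg_mul]
    ring
  rw [heq]
  exact ⟨_, h4⟩

lemma norm_reducedNoise_sq_le {σ b : ℝ} (hb : 0 < b) (hσ : |σ| ≤ b) (c : 𝕜) (t : ℝ) :
    ‖reducedNoise σ b c t‖ ^ 2 ≤ (Real.exp b * (√(2 * b) + ‖c‖ * √(2 * b))) ^ 2 := by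
  have h1 : σ * Real.sin t ≤ b := by
    refine (le_abs_self _).trans ?_
    rw [abs_mul]
    exact (mul_le_of_le_one_right (abs_nonneg _) (Real.abs_sin_le_one t)).trans hσ
  have h2 : 2 * b * Real.cos t ≤ 2 * b := mul_le_of_le_one_right (by positivity) (Real.cos_le_one t)
  have h3 : -(2 * b * Real.cos t) ≤ 2 * b := by nlinarith [Real.neg_one_le_cos t]
  rw [reducedNoise, norm_smul, Real.norm_eq_abs, Real.abs_exp]
  gcongr
  refine (norm_add_le _ _).trans ?_
  rw [norm_mul, RCLike.norm_ofReal, RCLike.norm_ofReal, abs_of_nonneg (Real.sqrt_nonneg _),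
    abs_of_nonneg (Real.sqrt_nonneg _)]
  gcongr

lemma exampleSDE_noise_zero (a b : ℝ) (c : 𝕜) (t : ℝ) :
    (exampleSDE a b c).noise t 0 = homSol a b t • reducedNoise b b c t := by
  rw [reducedNoise, homSol, smul_smul, ← Real.exp_add, RCLike.real_smul_eq_coe_mul]
  simp only [exampleSDE, PiLp.toLp_apply, Matrix.cons_val_zero]
  rw [mul_comm]
  congr 3
  ring

lemma exampleSDE_noise_one (a b : ℝ) (c : 𝕜) (t : ℝ) :
    (exampleSDE a b c).noise t 1 = (homSol a b t)⁻¹ • -reducedNoise (-b) b c t := by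
  rw [reducedNoise, homSol, smul_neg, smul_smul, ← Real.exp_neg, ← Real.exp_add,
    RCLike.real_smul_eq_coe_mul]
  simp only [exampleSDE, PiLp.toLp_apply, Matrix.cons_val_one, Matrix.cons_val_fin_one]
  rw [mul_comm]
  congr 4
  ring

end Noise

/-! ### Itô integrals and solutions -/

section Solutions

variable {𝕜 : Type*} [RCLike 𝕜] {n : ℕ} {Ω : Type*} [MeasurableSpace Ω] {P : Measure Ω}
  {W : ℝ≥0 → Ω → ℝ} {B : ℝ → Ω → ℝ}

lemma aestronglyMeasurable_itoSum (hWm : ∀ t, Measurable (W t))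
    (g : ℝ → EuclideanSpace 𝕜 (Fin n)) (t : ℝ) (N : ℕ) : AEStronglyMeasurable (itoSum W g t N) P :=
  Finset.aestronglyMeasurable_fun_sum _ fun _ _ =>
    (RCLike.continuous_ofReal.comp_aestronglyMeasurable
      ((hWm _).sub (hWm _)).aestronglyMeasurable).smul_const _

lemma IsItoIntegral.ae_eq (hWm : ∀ t, Measurable (W t)) {g : ℝ → EuclideanSpace 𝕜 (Fin n)} {t : ℝ}
    {Y Y' : Ω → EuclideanSpace 𝕜 (Fin n)} (hY : IsItoIntegral P W g t Y)
    (hY' : IsItoIntegral P W g t Y') : Y =ᵐ[P] Y' := by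
  have hle : ∀ N, eLpNorm (Y - Y') 2 P ≤
      eLpNorm (itoSum W g t N - Y') 2 P + eLpNorm (itoSum W g t N - Y) 2 P := fun N => by
    have h := eLpNorm_sub_le (p := 2) (μ := P) ((aestronglyMeasurable_itoSum hWm g t N).sub hY'.1.1)
      ((aestronglyMeasurable_itoSum hWm g t N).sub hY.1.1) (by norm_num)
    rwa [sub_sub_sub_cancel_left] at h
  have h0 : eLpNorm (Y - Y') 2 P ≤ 0 := by
    have := ge_of_tendsto' (hY'.2.add hY.2) hle
    simpa using this
  have h1 := (eLpNorm_eq_zero_iff (hY.1.1.sub hY'.1.1) two_ne_zero).1 (le_antisymm h0 zero_le)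
  filter_upwards [h1] with w hw
  exact sub_eq_zero.1 hw

lemma itoSum_apply_ae_eq (hB : IsContinuousVersion P W B) (g : ℝ → EuclideanSpace 𝕜 (Fin n))
    (t : ℝ) (N : ℕ) (i : Fin n) :
    (fun w => itoSum W g t N w i) =ᵐ[P] leftSum B (fun s => g s i) t N := by
  filter_upwards [hB.ae_eq] with w hw
  simp [itoSum, leftSum, hw, RCLike.real_smul_eq_coe_mul]

lemma eLpNorm_euclidean_le {F : Ω → EuclideanSpace 𝕜 (Fin n)}
    (hF : ∀ i, AEStronglyMeasurable (fun w => F w i) P) :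
    eLpNorm F 2 P ≤ ∑ i, eLpNorm (fun w => F w i) 2 P := by
  calc eLpNorm F 2 P ≤ eLpNorm (∑ i, fun w => ‖F w i‖) 2 P := by
        refine eLpNorm_mono_real fun w => ?_
        rw [Finset.sum_apply, EuclideanSpace.norm_eq]
        exact Real.sqrt_le_iff.2 ⟨by positivity,
          Finset.sum_sq_le_sq_sum_of_nonneg fun i _ => norm_nonneg _⟩
    _ ≤ ∑ i, eLpNorm (fun w => ‖F w i‖) 2 P :=
        eLpNorm_sum_le (fun i _ => (hF i).norm) (by norm_num)
    _ = _ := by simp only [eLpNorm_norm]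

/-- The vector of the pathwise Wiener integrals of the components is the Itô integral. -/
lemma isItoIntegral_wienerIntegral [IsProbabilityMeasure P]
    (hB : IsContinuousVersion P W B) (hW : IsBrownianReal W P)
    {g : ℝ → EuclideanSpace 𝕜 (Fin n)} {g' : Fin n → ℝ → 𝕜}
    (hg : ∀ i, HasIntegrableDeriv (fun t => g t i) (g' i)) {t : ℝ} (ht : 0 ≤ t) :
    IsItoIntegral P W g t
      fun w => WithLp.toLp 2 fun i => wienerIntegral B (fun t => g t i) (g' i) t w := by
  have hmem : ∀ i, MemLp (wienerIntegral B (fun t => g t i) (g' i) t) 2 P := fun i =>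
    memLp_wienerIntegral hB hW (hg i) ht
  refine ⟨MemLp.of_eval_piLp hmem, ?_⟩
  have hcomp : ∀ N i, (fun w => (itoSum W g t N -
      fun w => WithLp.toLp 2 fun i => wienerIntegral B (fun t => g t i) (g' i) t w) w i) =ᵐ[P]
      leftSum B (fun s => g s i) t N - wienerIntegral B (fun t => g t i) (g' i) t := by
    intro N i
    filter_upwards [itoSum_apply_ae_eq hB g t N i] with w hw
    simp only [Pi.sub_apply, PiLp.sub_apply, hw]
  have hlim : Tendsto (fun N => ∑ i, eLpNorm (leftSum B (fun s => g s i) t N -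
      wienerIntegral B (fun t => g t i) (g' i) t) 2 P) atTop (𝓝 0) := by
    have := tendsto_finsetSum Finset.univ fun i _ => tendsto_leftSum hB hW (hg i) ht
    simpa using this
  refine tendsto_of_tendsto_of_tendsto_of_le_of_le tendsto_const_nhds hlim
    (fun _ => zero_le) fun N => ?_
  refine (eLpNorm_euclidean_le fun i => ?_).trans_eq
    (Finset.sum_congr rfl fun i _ => eLpNorm_congr_ae (hcomp N i))
  exact ((aestronglyMeasurable_leftSum hB _ t N).sub (hmem i).1).congr (hcomp N i).symm

end Solutions

/-- The Wiener integral up to time `t` only depends on the Brownian motion up to time `t`. -/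
lemma aestronglyMeasurable_wienerIntegral_of_le {𝕜 Ω : Type*} [RCLike 𝕜] {m m0 : MeasurableSpace Ω}
    (hm : m ≤ m0) {P : Measure Ω} [IsProbabilityMeasure P] {W : ℝ≥0 → Ω → ℝ} {B : ℝ → Ω → ℝ}
    (hB : IsContinuousVersion P W B) (hW : IsBrownianReal W P)
    {h h' : ℝ → 𝕜} (hh : HasIntegrableDeriv h h') {t : ℝ} (ht : 0 ≤ t)
    (hWm : ∀ r : ℝ, r ≤ t → Measurable[m] (W r.toNNReal)) :
    AEStronglyMeasurable[m] (wienerIntegral B h h' t) P := by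
  have hsum : ∀ N, AEStronglyMeasurable[m] (leftSum B h t N) P := by
    intro N
    refine ⟨fun w => ∑ i ∈ Finset.range N,
      (W (t * (i + 1) / N).toNNReal w - W (t * i / N).toNNReal w) • h (t * i / N), ?_, ?_⟩
    · refine Finset.stronglyMeasurable_fun_sum _ fun i hi => ?_
      have hN : (i : ℝ) + 1 ≤ N := by exact_mod_cast Finset.mem_range.1 hi
      have hN0 : (0 : ℝ) < N := by linarith [Nat.cast_nonneg (α := ℝ) i]
      have h1 : t * (i + 1) / N ≤ t := by
        rw [div_le_iff₀ hN0]; gcongr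
      have h2 : t * i / N ≤ t := by
        rw [div_le_iff₀ hN0]; exact mul_le_mul_of_nonneg_left (by linarith) ht
      exact ((hWm _ h1).sub (hWm _ h2)).stronglyMeasurable.smul_const _
    · filter_upwards [hB.ae_eq] with w hw
      simp [leftSum, hw]
  have hI := memLp_wienerIntegral hB hW hh ht
  have hlim := (Lp.tendsto_Lp_iff_tendsto_eLpNorm'' (leftSum B h t)
    (fun N => memLp_leftSum hB hW h t N) _ hI).2 (tendsto_leftSum hB hW hh ht)
  have hmem := (isClosed_aestronglyMeasurable (F := 𝕜) (p := 2) (μ := P) hm).mem_of_tendsto hlim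
    (Eventually.of_forall fun N => (hsum N).congr (MemLp.coeFn_toLp _).symm)
  exact AEStronglyMeasurable.congr hmem hI.coeFn_toLp

/-! ### Existence and uniqueness of the solution -/

section Example

variable {𝕜 : Type*} [RCLike 𝕜] {Ω : Type*} [MeasurableSpace Ω] {P : Measure Ω}
  {W : ℝ≥0 → Ω → ℝ} {B : ℝ → Ω → ℝ} {a b : ℝ} {c : 𝕜}

/-- The diagonal entries of the drift matrix. -/
def driftRate (a b : ℝ) (i : Fin 2) (t : ℝ) : ℝ :=
  ![-a - b * t * Real.sin t, a + b * t * Real.sin t] i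

/-- The solutions of the two homogeneous equations with initial value `1`. -/
def homSols (a b : ℝ) (i : Fin 2) (t : ℝ) : ℝ := ![homSol a b t, (homSol a b t)⁻¹] i

lemma continuous_driftRate (a b : ℝ) (i : Fin 2) : Continuous (driftRate a b i) := by
  fin_cases i
  · change Continuous fun t => -a - b * t * Real.sin t
    fun_prop
  · change Continuous fun t => a + b * t * Real.sin t
    fun_prop

lemma hasDerivAt_homSols (a b : ℝ) (i : Fin 2) (t : ℝ) :
    HasDerivAt (homSols a b i) (driftRate a b i t * homSols a b i t) t := by
  fin_cases i
  · exact hasDerivAt_homSol a b t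
  · exact hasDerivAt_homSol_inv a b t

lemma homSols_pos (a b : ℝ) (i : Fin 2) (t : ℝ) : 0 < homSols a b i t := by
  fin_cases i
  · exact homSol_pos a b t
  · exact inv_pos.2 (homSol_pos a b t)

lemma homSols_zero (a b : ℝ) (i : Fin 2) : homSols a b i 0 = 1 := by
  fin_cases i <;> simp [homSols]

lemma continuous_homSols (a b : ℝ) (i : Fin 2) : Continuous (homSols a b i) :=
  continuous_iff_continuousAt.2 fun t => (hasDerivAt_homSols a b i t).continuousAt

lemma hasIntegrableDeriv_homSols (a b : ℝ) (i : Fin 2) :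
    HasIntegrableDeriv (homSols a b i) fun t => driftRate a b i t * homSols a b i t :=
  .of_hasDerivAt (hasDerivAt_homSols a b i)
    ((continuous_driftRate a b i).mul (continuous_homSols a b i))

lemma drift_apply (x : EuclideanSpace 𝕜 (Fin 2)) (t : ℝ) (i : Fin 2) :
    Matrix.toEuclideanCLM (𝕜 := 𝕜) ((exampleSDE a b c).drift t) x i = driftRate a b i t • x i := by
  rw [Matrix.ofLp_toEuclideanCLM]
  fin_cases i <;>
    simp [exampleSDE, driftRate, Matrix.mulVec, dotProduct, Fin.sum_univ_two,
      RCLike.real_smul_eq_coe_mul]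

lemma integral_drift_apply {x : ℝ → EuclideanSpace 𝕜 (Fin 2)} (hx : ContinuousOn x (Set.Ici 0))
    {t : ℝ} (ht : 0 ≤ t) (i : Fin 2) :
    (∫ s in (0 : ℝ)..t, Matrix.toEuclideanCLM (𝕜 := 𝕜) ((exampleSDE a b c).drift s) (x s)) i =
      ∫ s in (0 : ℝ)..t, driftRate a b i s • x s i := by
  have hcont : ContinuousOn
      (fun s => Matrix.toEuclideanCLM (𝕜 := 𝕜) ((exampleSDE a b c).drift s) (x s))
      (Set.uIcc 0 t) := by
    rw [Set.uIcc_of_le ht]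
    have h : ContinuousOn (fun s => WithLp.ofLp
        (Matrix.toEuclideanCLM (𝕜 := 𝕜) ((exampleSDE a b c).drift s) (x s))) (Set.Icc 0 t) := by
      refine continuousOn_pi.2 fun j => ?_
      simp only [drift_apply]
      exact (continuous_driftRate a b j).continuousOn.smul
        ((PiLp.continuous_apply 2 _ j).comp_continuousOn (hx.mono Set.Icc_subset_Ici_self))
    exact (PiLp.continuous_toLp 2 _).comp_continuousOn h
  have h := (EuclideanSpace.proj i : EuclideanSpace 𝕜 (Fin 2) →L[𝕜] 𝕜).intervalIntegral_comp_comm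
    (hcont.intervalIntegrable (μ := volume))
  simp only [PiLp.proj_apply, drift_apply] at h
  exact h.symm

/-- The coefficients of the Wiener integrals in the variation of constants formula. -/
def reducedNoises (b : ℝ) (c : 𝕜) (i : Fin 2) (t : ℝ) : 𝕜 :=
  ![reducedNoise b b c t, -reducedNoise (-b) b c t] i

lemma exists_hasIntegrableDeriv_reducedNoises (hb : 0 < b) (c : 𝕜) :
    ∃ h' : Fin 2 → ℝ → 𝕜, ∀ i, HasIntegrableDeriv (reducedNoises b c i) (h' i) := by
  obtain ⟨f, hf⟩ := exists_hasIntegrableDeriv_reducedNoise b hb c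
  obtain ⟨g, hg⟩ := exists_hasIntegrableDeriv_reducedNoise (-b) hb c
  refine ⟨![f, fun t => -g t], fun i => ?_⟩
  fin_cases i
  · exact hf
  · exact hg.neg

lemma noise_apply (t : ℝ) (i : Fin 2) :
    (exampleSDE a b c).noise t i = homSols a b i t • reducedNoises b c i t := by
  fin_cases i
  · exact exampleSDE_noise_zero a b c t
  · exact exampleSDE_noise_one a b c t

/-- The variation of constants formula `φᵢ(t) (1 + ∫₀ᵗ hᵢ dB)`, `i = 1, 2`. -/
def variationOfConstants (a b : ℝ) (c : 𝕜) (h' : Fin 2 → ℝ → 𝕜) (B : ℝ → Ω → ℝ) (t : ℝ) (w : Ω) :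
    EuclideanSpace 𝕜 (Fin 2) :=
  WithLp.toLp 2 fun i =>
    homSols a b i t • (1 + wienerIntegral B (reducedNoises b c i) (h' i) t w)

lemma isSolution_variationOfConstants [IsProbabilityMeasure P] (hWm : ∀ t, Measurable (W t))
    (hW : IsBrownianReal W P) (hB : IsContinuousVersion P W B) {h' : Fin 2 → ℝ → 𝕜}
    (hh : ∀ i, HasIntegrableDeriv (reducedNoises b c i) (h' i)) :
    (exampleSDE a b c).IsSolution P W !₂[1, 1] (variationOfConstants a b c h' B) where
  adapted t ht := by
    have hm : (⨆ r : Set.Iic t.toNNReal, MeasurableSpace.comap (W r) (borel ℝ)) ≤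
        ‹MeasurableSpace Ω› := iSup_le fun r => by
      rw [← BorelSpace.measurable_eq (α := ℝ)]; exact (hWm r).comap_le
    have hWr : ∀ r : ℝ, r ≤ t → Measurable[⨆ r : Set.Iic t.toNNReal,
        MeasurableSpace.comap (W r) (borel ℝ)] (W r.toNNReal) := fun r hr => by
      have h1 := le_iSup (fun r : Set.Iic t.toNNReal => MeasurableSpace.comap (W r) (borel ℝ))
          ⟨r.toNNReal, Real.toNNReal_le_toNNReal hr⟩
      refine Measurable.mono ?_ h1 le_rfl
      rw [← BorelSpace.measurable_eq (α := ℝ)]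
      exact comap_measurable (W r.toNNReal)
    have hI := fun i => aestronglyMeasurable_wienerIntegral_of_le hm hB hW (hh i) ht hWr
    have hg : Continuous fun p : 𝕜 × 𝕜 => (WithLp.toLp 2
        ![homSols a b 0 t • (1 + p.1), homSols a b 1 t • (1 + p.2)] :
        EuclideanSpace 𝕜 (Fin 2)) := by
      refine (PiLp.continuous_toLp 2 _).comp (continuous_pi fun i => ?_)
      fin_cases i
      · exact (continuous_const.add continuous_fst).const_smul (homSols a b 0 t)
      · exact (continuous_const.add continuous_snd).const_smul (homSols a b 1 t)
    refine (hg.comp_aestronglyMeasurable ((hI 0).prodMk (hI 1))).congr (ae_of_all _ fun w => ?_)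
    ext i
    fin_cases i <;> rfl
  continuous_paths := ae_of_all _ fun w => by
    refine Continuous.continuousOn ((PiLp.continuous_toLp 2 _).comp (continuous_pi fun i => ?_))
    exact (continuous_homSols a b i).smul (continuous_const.add
      (((hB.continuous w).smul (hh i).continuous).sub
        ((hh i).primitive (hB.continuous w)).continuous))
  equation t ht := by
    have hg : ∀ i, HasIntegrableDeriv (fun t => (exampleSDE a b c).noise t i) _ := fun i => by
      simp only [noise_apply]
      exact (hasIntegrableDeriv_homSols a b i).smul (hh i)
    refine ⟨_, isItoIntegral_wienerIntegral hB hW hg ht, ae_of_all _ fun w => ?_⟩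
    have hcI : ∀ i, Continuous fun s => wienerIntegral B (reducedNoises b c i) (h' i) s w :=
      fun i => ((hB.continuous w).smul (hh i).continuous).sub ((hh i).primitive (hB.continuous w)).continuous
    have hc : ContinuousOn (fun s => variationOfConstants a b c h' B s w) (Set.Ici 0) :=
      Continuous.continuousOn ((PiLp.continuous_toLp 2 _).comp (continuous_pi fun i =>
        (continuous_homSols a b i).smul (continuous_const.add (hcI i))))
    ext i
    have h1 : (!₂[1, 1] : EuclideanSpace 𝕜 (Fin 2)) i = 1 := by fin_cases i <;> rfl
    rw [PiLp.add_apply, PiLp.add_apply, integral_drift_apply hc ht, h1]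
    simp only [variationOfConstants, noise_apply]
    have h2 := (hasIntegrableDeriv_homSols a b i).integral_eq 0 t
    have h3 := smul_wienerIntegral_eq (hasIntegrableDeriv_homSols a b i) (hh i) (hB.continuous w) t
    have h4 : ∫ s in (0 : ℝ)..t, driftRate a b i s • homSols a b i s •
        (1 + wienerIntegral B (reducedNoises b c i) (h' i) s w) =
        (∫ s in (0 : ℝ)..t, (driftRate a b i s * homSols a b i s) • (1 : 𝕜)) +
        ∫ s in (0 : ℝ)..t, driftRate a b i s • homSols a b i s •
          wienerIntegral B (reducedNoises b c i) (h' i) s w := by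
      rw [← intervalIntegral.integral_add]
      · simp only [smul_add, smul_smul]
      · exact (((continuous_driftRate a b i).mul (continuous_homSols a b i)).smul
          continuous_const).intervalIntegrable _ _
      · exact ((continuous_driftRate a b i).smul
          ((continuous_homSols a b i).smul (hcI i))).intervalIntegrable _ _
    rw [h4, smul_add, h3, intervalIntegral.integral_smul_const, h2, homSols_zero, sub_smul, one_smul]
    abel

/-- A function, continuous on `[0, ∞)`, with `y(t) = ∫₀ᵗ r y ds` for all rational `t ≥ 0`
vanishes on `[0, ∞)`. -/
lemma eq_zero_of_integral_eq {r φ : ℝ → ℝ} (hr : Continuous r)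
    (hφ : ∀ t, HasDerivAt φ (r t * φ t) t) (hφ0 : ∀ t, φ t ≠ 0) {y : ℝ → 𝕜}
    (hy : ContinuousOn y (Set.Ici 0))
    (heq : ∀ q : ℚ, 0 ≤ q → y q = ∫ s in (0 : ℝ)..q, r s • y s) {t : ℝ} (ht : 0 ≤ t) : y t = 0 := by
  -- `y` is extended to the left by its value at `0`, so that both sides are continuous on `ℝ`
  have hmax : Continuous fun s : ℝ => max s 0 := by fun_prop
  have hyc : Continuous fun s => y (max s 0) :=
    hy.comp_continuous hmax fun s => le_max_right s 0
  set z : ℝ → 𝕜 := fun t => ∫ s in (0 : ℝ)..t, r s • y (max s 0) with hz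
  have hfc : Continuous fun s => r s • y (max s 0) := hr.smul hyc
  have hzd : ∀ t, HasDerivAt z (r t • y (max t 0)) t := fun t =>
    intervalIntegral.integral_hasDerivAt_right (hfc.intervalIntegrable _ _)
      hfc.stronglyMeasurable.stronglyMeasurableAtFilter hfc.continuousAt
  have hzc : Continuous z := continuous_iff_continuousAt.2 fun t => (hzd t).continuousAt
  have hq : ∀ q : ℚ, 0 ≤ q → y q = z q := fun q h0 => by
    rw [heq q h0]
    refine intervalIntegral.integral_congr fun s hs => ?_
    rw [Set.uIcc_of_le (by exact_mod_cast h0)] at hs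
    simp only [max_eq_left hs.1]
  have hyz : (fun s => y (max s 0)) = fun s => z (max s 0) := by
    refine Rat.denseRange_cast.equalizer hyc (hzc.comp hmax) (funext fun q => ?_)
    simpa using hq (max q 0) (le_max_right q 0)
  have hyz' : ∀ s, 0 ≤ s → y s = z s := fun s hs => by
    simpa [max_eq_left hs] using congrFun hyz s
  have := eq_smul_of_hasDerivWithinAt hφ hφ0 (y := z) (fun s hs =>
    (hzd s).hasDerivWithinAt.congr_deriv (by rw [max_eq_left hs, hyz' s hs])) ht
  rw [hyz' t ht, this]
  simp [hz]

/-- Uniqueness: the Itô integrals cancel, and the difference of two solutions solves the homogeneous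
equation path by path. -/
lemma isSolution_ae_eq (hWm : ∀ t, Measurable (W t)) {x₀ : EuclideanSpace 𝕜 (Fin 2)}
    {X X' : ℝ → Ω → EuclideanSpace 𝕜 (Fin 2)} (hX : (exampleSDE a b c).IsSolution P W x₀ X)
    (hX' : (exampleSDE a b c).IsSolution P W x₀ X') {t : ℝ} (ht : 0 ≤ t) : X t =ᵐ[P] X' t := by
  have hrat : ∀ᵐ w ∂P, ∀ q : ℚ, 0 ≤ q → X q w - X' q w =
      (∫ s in (0 : ℝ)..q, Matrix.toEuclideanCLM (𝕜 := 𝕜) ((exampleSDE a b c).drift s) (X s w)) -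
      ∫ s in (0 : ℝ)..q, Matrix.toEuclideanCLM (𝕜 := 𝕜) ((exampleSDE a b c).drift s) (X' s w) := by
    refine ae_all_iff.2 fun q => ?_
    by_cases hq : 0 ≤ q
    · obtain ⟨Y, hY, h⟩ := hX.equation q (by exact_mod_cast hq)
      obtain ⟨Y', hY', h'⟩ := hX'.equation q (by exact_mod_cast hq)
      filter_upwards [h, h', hY.ae_eq hWm hY'] with w h1 h2 h3 _
      rw [h1, h2, h3]; abel
    · exact ae_of_all _ fun w h => absurd h hq
  filter_upwards [hX.continuous_paths, hX'.continuous_paths, hrat] with w hc hc' hw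
  have hci : ∀ i : Fin 2, ContinuousOn (fun t => X t w i) (Set.Ici 0) := fun i =>
    (PiLp.continuous_apply 2 _ i).comp_continuousOn hc
  have hci' : ∀ i : Fin 2, ContinuousOn (fun t => X' t w i) (Set.Ici 0) := fun i =>
    (PiLp.continuous_apply 2 _ i).comp_continuousOn hc'
  ext i
  refine sub_eq_zero.1 (eq_zero_of_integral_eq (y := fun t => X t w i - X' t w i)
    (continuous_driftRate a b i) (hasDerivAt_homSols a b i) (fun t => (homSols_pos a b i t).ne')
    ((hci i).sub (hci' i)) (fun q hq => ?_) ht)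
  have hq' : (0 : ℝ) ≤ q := by exact_mod_cast hq
  have hii : ∀ {f : ℝ → 𝕜}, ContinuousOn f (Set.Ici 0) →
      IntervalIntegrable (fun s => driftRate a b i s • f s) volume 0 q := fun hf => by
    refine ContinuousOn.intervalIntegrable ?_
    rw [Set.uIcc_of_le hq']
    exact (continuous_driftRate a b i).continuousOn.smul (hf.mono Set.Icc_subset_Ici_self)
  have h := congrArg (fun x : EuclideanSpace 𝕜 (Fin 2) => x i) (hw q hq)
  simp only [PiLp.sub_apply, integral_drift_apply hc hq', integral_drift_apply hc' hq'] at h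
  rw [h, ← intervalIntegral.integral_sub (hii (hci i)) (hii (hci' i))]
  simp only [smul_sub]

/-! ### Second moments of the solution -/

/-- The variance `∫₀ᵗ |hᵢ|² ds` of the Wiener integral in the variation of constants formula. -/
def noiseVariance (b : ℝ) (c : 𝕜) (i : Fin 2) (t : ℝ) : ℝ :=
  ∫ s in (0 : ℝ)..t, ‖reducedNoises b c i s‖ ^ 2

/-- By uniqueness and the Itô isometry, `E|u(t)|² = φ(t)² (1 + J₁(t))` and
`E|v(t)|² = φ(t)⁻² (1 + J₂(t))` for every solution. -/
lemma secondMoment_solution [IsProbabilityMeasure P] (hWm : ∀ t, Measurable (W t))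
    (hW : IsBrownianReal W P) (hb : 0 < b) {X : ℝ → Ω → EuclideanSpace 𝕜 (Fin 2)}
    (hX : (exampleSDE a b c).IsSolution P W !₂[1, 1] X) {t : ℝ} (ht : 0 ≤ t) :
    MemLp (X t) 2 P ∧ ∀ i, secondMoment P (fun w => X t w i) =
      homSols a b i t ^ 2 * (1 + noiseVariance b c i t) := by
  obtain ⟨B, hB⟩ := exists_continuousVersion hWm hW
  obtain ⟨h', hh⟩ := exists_hasIntegrableDeriv_reducedNoises hb c
  have hae := isSolution_ae_eq hWm hX (isSolution_variationOfConstants hWm hW hB hh) ht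
  constructor
  · refine MemLp.ae_eq hae.symm (MemLp.of_eval_piLp fun i => ?_)
    have hone : MemLp (fun _ : Ω => (1 : 𝕜)) 2 P := memLp_const 1
    have hsum : MemLp (fun w => 1 + wienerIntegral B (reducedNoises b c i) (h' i) t w) 2 P :=
      hone.add (memLp_wienerIntegral hB hW (hh i) ht)
    exact hsum.const_smul (homSols a b i t)
  · intro i
    rw [noiseVariance, ← integral_norm_one_add_wienerIntegral_sq hB hW (hh i) ht, secondMoment,
      ← integral_const_mul]
    refine integral_congr_ae ?_
    filter_upwards [hae] with w hw
    rw [hw, variationOfConstants, norm_smul, mul_pow, Real.norm_eq_abs, sq_abs]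

/-- The variances are nonnegative and nondecreasing, and they grow at most linearly. -/
lemma exists_noiseVariance_sub_le (hb : 0 < b) (c : 𝕜) :
    ∃ C, 0 ≤ C ∧ ∀ i s t, 0 ≤ s → s ≤ t → 0 ≤ noiseVariance b c i s ∧
      noiseVariance b c i s ≤ noiseVariance b c i t ∧
      noiseVariance b c i t ≤ noiseVariance b c i s + C * (t - s) := by
  refine ⟨(Real.exp b * (√(2 * b) + ‖c‖ * √(2 * b))) ^ 2, sq_nonneg _, fun i s t hs hst => ?_⟩
  obtain ⟨h', hh⟩ := exists_hasIntegrableDeriv_reducedNoises hb c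
  have hc : Continuous fun s => ‖reducedNoises b c i s‖ ^ 2 := (hh i).continuous.norm.pow 2
  have hle : ∀ s, ‖reducedNoises b c i s‖ ^ 2 ≤
      (Real.exp b * (√(2 * b) + ‖c‖ * √(2 * b))) ^ 2 := fun s => by
    fin_cases i
    · exact norm_reducedNoise_sq_le hb (abs_of_pos hb).le c s
    · change ‖-reducedNoise (-b) b c s‖ ^ 2 ≤ _
      rw [norm_neg]
      exact norm_reducedNoise_sq_le hb (by rw [abs_neg, abs_of_pos hb]) c s
  have hadd : noiseVariance b c i t = noiseVariance b c i s +
      ∫ s in s..t, ‖reducedNoises b c i s‖ ^ 2 :=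
    (intervalIntegral.integral_add_adjacent_intervals (hc.intervalIntegrable _ _)
      (hc.intervalIntegrable _ _)).symm
  refine ⟨intervalIntegral.integral_nonneg hs fun _ _ => sq_nonneg _, ?_, ?_⟩
  · rw [hadd]
    exact le_add_of_nonneg_right (intervalIntegral.integral_nonneg hst fun _ _ => sq_nonneg _)
  · rw [hadd]
    gcongr
    refine (intervalIntegral.integral_mono_on hst (hc.intervalIntegrable _ _)
      intervalIntegrable_const fun x _ => hle x).trans_eq ?_
    rw [intervalIntegral.integral_const, smul_eq_mul, mul_comm]

end Example

/-! ### The dichotomy of the second moments -/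

/-- The linear growth of the variance `J` costs half of the exponential rate `2 (a - b)`, by
`1 + C x ≤ (1 + C / δ) e^{δ x}` with `δ = a - b`. -/
lemma secondMoment_fst_le {a b C s t : ℝ} {J : ℝ → ℝ} (hb : 0 < b) (hab : b < a) (hC : 0 ≤ C)
    (hs : 0 ≤ s) (hst : s ≤ t) (h0 : 0 ≤ J s) (h2 : J t ≤ J s + C * (t - s)) :
    homSol a b t ^ 2 * (1 + J t) ≤
      Real.exp (4 * b) * (1 + C / (a - b)) * Real.exp (-(a - b) * (t - s) + 4 * b * s) *
        (homSol a b s ^ 2 * (1 + J s)) := by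
  have hδ : 0 < a - b := sub_pos.2 hab
  have hts : 0 ≤ t - s := sub_nonneg.2 hst
  have hJ : 1 + J t ≤ (1 + J s) * ((1 + C / (a - b)) * Real.exp ((a - b) * (t - s))) := by
    have h3 : 1 + C * (t - s) ≤ (1 + C / (a - b)) * Real.exp ((a - b) * (t - s)) := by
      refine le_trans ?_ (mul_le_mul_of_nonneg_left (Real.add_one_le_exp _) (by positivity))
      have : (1 + C / (a - b)) * ((a - b) * (t - s) + 1) =
          1 + C * (t - s) + ((a - b) * (t - s) + C / (a - b)) := by field_simp; ring
      rw [this]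
      have : 0 ≤ (a - b) * (t - s) + C / (a - b) := by positivity
      linarith
    refine le_trans ?_ (mul_le_mul_of_nonneg_left h3 (by linarith))
    nlinarith [mul_nonneg (mul_nonneg hC hts) h0]
  have hφ := homSol_sq_le (a := a) hb hs hst
  have hexp : Real.exp (-(2 * (a - b)) * (t - s) + 4 * b * s) * Real.exp ((a - b) * (t - s)) =
      Real.exp (-(a - b) * (t - s) + 4 * b * s) := by
    rw [← Real.exp_add]; congr 1; ring
  by_cases hneg : 1 + J t ≤ 0
  · exact (mul_nonpos_of_nonneg_of_nonpos (sq_nonneg _) hneg).trans (by positivity)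
  · refine (mul_le_mul hφ hJ (not_le.1 hneg).le (by positivity)).trans_eq ?_
    rw [← hexp]; ring

/-- For the second component the monotonicity of the variance `J` already helps: the estimate runs
backwards in time. -/
lemma secondMoment_snd_le {a b C s t : ℝ} {J : ℝ → ℝ} (hb : 0 < b) (hab : b < a) (hC : 0 ≤ C)
    (ht : 0 ≤ t) (hts : t ≤ s) (h0 : 0 ≤ J t) (h1 : J t ≤ J s) :
    (homSol a b t)⁻¹ ^ 2 * (1 + J t) ≤
      Real.exp (4 * b) * (1 + C / (a - b)) * Real.exp (-(a - b) * (s - t) + 4 * b * s) *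
        ((homSol a b s)⁻¹ ^ 2 * (1 + J s)) := by
  have hδ : 0 < a - b := sub_pos.2 hab
  have hφ : (homSol a b t)⁻¹ ^ 2 ≤ Real.exp (4 * b) *
      Real.exp (-(2 * (a - b)) * (s - t) + 4 * b * t) * (homSol a b s)⁻¹ ^ 2 := by
    have h := homSol_sq_le (a := a) hb ht hts
    have hs2 := pow_pos (homSol_pos a b s) 2
    have ht2 := pow_pos (homSol_pos a b t) 2
    rw [inv_pow, inv_pow, ← div_eq_mul_inv, le_div_iff₀ hs2, inv_mul_le_iff₀ ht2]
    linarith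
  calc (homSol a b t)⁻¹ ^ 2 * (1 + J t)
      ≤ Real.exp (4 * b) * Real.exp (-(2 * (a - b)) * (s - t) + 4 * b * t) *
          (homSol a b s)⁻¹ ^ 2 * (1 + J s) := by gcongr
    _ ≤ Real.exp (4 * b) * (1 + C / (a - b)) * Real.exp (-(a - b) * (s - t) + 4 * b * s) *
          (homSol a b s)⁻¹ ^ 2 * (1 + J s) := by
        have hJs : 0 ≤ 1 + J s := by linarith
        have h3 : Real.exp (4 * b) ≤ Real.exp (4 * b) * (1 + C / (a - b)) :=
          le_mul_of_one_le_right (Real.exp_pos _).le (le_add_of_nonneg_right (by positivity))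
        have h4 : -(2 * (a - b)) * (s - t) + 4 * b * t ≤ -(a - b) * (s - t) + 4 * b * s := by
          nlinarith [mul_nonneg hδ.le (sub_nonneg.2 hts), mul_le_mul_of_nonneg_left hts hb.le]
        gcongr
    _ = _ := by ring

end

theorem mainTheorem8 {𝕜 : Type*} [RCLike 𝕜] {Ω : Type*} [MeasurableSpace Ω] (P : Measure Ω)
    [IsProbabilityMeasure P] (W : ℝ≥0 → Ω → ℝ) (hWm : ∀ t, Measurable (W t))
    (hW : IsBrownianReal W P) (a b : ℝ) (hb : 0 < b) (hab : b < a) (c : 𝕜) :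
    -- the equation admits an NMS-ED that is not a uniform MS-ED
    ((exampleSDE a b c).AdmitsNMSED P ∧ ¬ (exampleSDE a b c).AdmitsUniformMSED P) ∧
    -- the nonuniform factor `exp (4 b s)` suffices, and it is attained along odd multiples of `π`
    (exampleSDE a b c).HasMSDichotomy P (Real.exp (4 * b)) (2 * (a - b)) (4 * b) ∧
    (∀ Φ, (exampleSDE a b c).IsFundamentalMatrix Φ → ∀ k : ℕ, Odd k →
      ‖(Φ (4 * k * Real.pi) * (Φ (3 * k * Real.pi))⁻¹) 0 0‖ ^ 2 =
        Real.exp (-2 * (a - b) * (4 * k * Real.pi - 3 * k * Real.pi)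
          + 4 * b * (3 * k * Real.pi)) ∧
      ‖(Φ (3 * k * Real.pi) * (Φ (4 * k * Real.pi))⁻¹) 1 1‖ ^ 2 =
        Real.exp (-2 * (a - b) * (4 * k * Real.pi - 3 * k * Real.pi)
          + 4 * b * (3 * k * Real.pi))) ∧
    -- the solution with `u(0) = v(0) = 1` exists, and its second moments behave accordingly
    (∃ X, (exampleSDE a b c).IsSolution P W !₂[1, 1] X) ∧
    (∀ X, (exampleSDE a b c).IsSolution P W !₂[1, 1] X →
      (∀ t, 0 ≤ t → MemLp (X t) 2 P) ∧
      (∃ M α ε : ℝ, 0 < M ∧ 0 < α ∧ 0 ≤ ε ∧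
        (∀ t s, 0 ≤ s → s ≤ t → secondMoment P (fun w => X t w 0) ≤
          M * Real.exp (-α * (t - s) + ε * |s|) * secondMoment P (fun w => X s w 0)) ∧
        (∀ t s, 0 ≤ t → t ≤ s → secondMoment P (fun w => X t w 1) ≤
          M * Real.exp (-α * (s - t) + ε * |s|) * secondMoment P (fun w => X s w 1))) ∧
      (¬ ∃ M α : ℝ, 0 < M ∧ 0 < α ∧
        ∀ t s, 0 ≤ s → s ≤ t → secondMoment P (fun w => X t w 0) ≤
          M * Real.exp (-α * (t - s)) * secondMoment P (fun w => X s w 0)) ∧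
      (¬ ∃ M α : ℝ, 0 < M ∧ 0 < α ∧
        ∀ t s, 0 ≤ t → t ≤ s → secondMoment P (fun w => X t w 1) ≤
          M * Real.exp (-α * (s - t)) * secondMoment P (fun w => X s w 1)) ∧
      (∀ k : ℕ, Odd k →
        Real.exp (-2 * (a - b) * (4 * k * Real.pi - 3 * k * Real.pi)
            + 4 * b * (3 * k * Real.pi)) * secondMoment P (fun w => X (3 * k * Real.pi) w 0)
          ≤ secondMoment P (fun w => X (4 * k * Real.pi) w 0))) := by
  refine ⟨⟨⟨Real.exp (4 * b), 2 * (a - b), 4 * b, Real.exp_pos _, by linarith, by positivity,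
    hasMSDichotomy_example P hb c⟩, not_admitsUniformMSED_example P hb hab c⟩,
    hasMSDichotomy_example P hb c, fun Φ hΦ k hk => norm_transition_peak hΦ hk, ?_, fun X hX => ?_⟩
  · obtain ⟨B, hB⟩ := exists_continuousVersion hWm hW
    obtain ⟨h', hh⟩ := exists_hasIntegrableDeriv_reducedNoises hb c
    exact ⟨_, isSolution_variationOfConstants hWm hW hB hh⟩
  · have hmom := fun t (ht : 0 ≤ t) => secondMoment_solution hWm hW hb hX ht
    have hu : ∀ t, 0 ≤ t → secondMoment P (fun w => X t w 0) =
        homSol a b t ^ 2 * (1 + noiseVariance b c 0 t) := fun t ht => (hmom t ht).2 0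
    have hv : ∀ t, 0 ≤ t → secondMoment P (fun w => X t w 1) =
        (homSol a b t)⁻¹ ^ 2 * (1 + noiseVariance b c 1 t) := fun t ht => (hmom t ht).2 1
    obtain ⟨C, hC, hJ⟩ := exists_noiseVariance_sub_le hb c
    refine ⟨fun t ht => (hmom t ht).1, ?_, ?_, ?_, fun k hk => ?_⟩
    · have hδ : 0 < a - b := sub_pos.2 hab
      refine ⟨Real.exp (4 * b) * (1 + C / (a - b)), a - b, 4 * b, by positivity, hδ,
        by positivity, fun t s hs hst => ?_, fun t s ht hts => ?_⟩
      · rw [hu t (hs.trans hst), hu s hs, abs_of_nonneg hs]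
        obtain ⟨h0, -, h2⟩ := hJ 0 s t hs hst
        exact secondMoment_fst_le hb hab hC hs hst h0 h2
      · rw [hv t ht, hv s (ht.trans hts), abs_of_nonneg (ht.trans hts)]
        obtain ⟨h0, h1, -⟩ := hJ 1 t s ht hts
        exact secondMoment_snd_le hb hab hC ht hts h0 h1
    · rintro ⟨M, α, hM, hα, h⟩
      obtain ⟨k, hk⟩ := exists_half_period_gt a hb M
      set s : ℝ := (2 * k + 1) * Real.pi with hs_def
      have hs : 0 ≤ s := by positivity
      have hst : s ≤ s + Real.pi := by linarith [Real.pi_pos]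
      obtain ⟨h0, h1, -⟩ := hJ 0 s (s + Real.pi) hs hst
      have hle := h (s + Real.pi) s hs hst
      rw [hu _ (hs.trans hst), hu s hs, homSol_half_period, ← hs_def] at hle
      have hφ := pow_pos (homSol_pos a b s) 2
      have hexp : Real.exp (-α * (s + Real.pi - s)) ≤ 1 :=
        Real.exp_le_one_iff.2 (by nlinarith [mul_pos hα Real.pi_pos])
      have hlt : M * Real.exp (-α * (s + Real.pi - s)) <
          Real.exp (-2 * a * Real.pi + 2 * b * (4 * k + 3) * Real.pi) :=
        (mul_le_of_le_one_right hM.le hexp).trans_lt hk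
      have hpos : 0 < homSol a b s ^ 2 * (1 + noiseVariance b c 0 s) := by positivity
      refine absurd hle (not_le.2 ((mul_lt_mul_of_pos_right hlt hpos).trans_le ?_))
      exact (mul_assoc _ _ _).symm.le.trans (by gcongr)
    · rintro ⟨M, α, hM, hα, h⟩
      obtain ⟨k, hk⟩ := exists_half_period_gt a hb (M * (1 + C * Real.pi))
      set t : ℝ := (2 * k + 1) * Real.pi with ht_def
      set G := Real.exp (-2 * a * Real.pi + 2 * b * (4 * k + 3) * Real.pi) with hG
      have ht : 0 ≤ t := by positivity
      have hts : t ≤ t + Real.pi := by linarith [Real.pi_pos]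
      obtain ⟨h0, -, h2⟩ := hJ 1 t (t + Real.pi) ht hts
      have hle := h t (t + Real.pi) ht hts
      rw [hv t ht, hv _ (ht.trans hts), inv_pow, inv_pow, homSol_half_period, ← ht_def, ← hG,
        mul_inv] at hle
      have hφ : 0 < (homSol a b t ^ 2)⁻¹ := inv_pos.2 (pow_pos (homSol_pos a b t) 2)
      have hexp : Real.exp (-α * (t + Real.pi - t)) ≤ 1 :=
        Real.exp_le_one_iff.2 (by nlinarith [mul_pos hα Real.pi_pos])
      have hJ2 : 1 + noiseVariance b c 1 (t + Real.pi) ≤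
          (1 + C * Real.pi) * (1 + noiseVariance b c 1 t) := by
        rw [add_sub_cancel_left] at h2
        nlinarith [mul_nonneg (mul_nonneg hC Real.pi_pos.le) h0]
      have hGpos : 0 < G := Real.exp_pos _
      have hbound : M * Real.exp (-α * (t + Real.pi - t)) *
          (G⁻¹ * (homSol a b t ^ 2)⁻¹ * (1 + noiseVariance b c 1 (t + Real.pi))) ≤
          M * 1 * (G⁻¹ * (homSol a b t ^ 2)⁻¹ *
            ((1 + C * Real.pi) * (1 + noiseVariance b c 1 t))) := by
        have hJ1 : 0 ≤ 1 + noiseVariance b c 1 (t + Real.pi) := by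
          linarith [(hJ 1 t (t + Real.pi) ht hts).2.1]
        gcongr
      have hfin := hle.trans hbound
      have hrw : M * 1 * (G⁻¹ * (homSol a b t ^ 2)⁻¹ *
          ((1 + C * Real.pi) * (1 + noiseVariance b c 1 t))) =
          (M * (1 + C * Real.pi) / G) *
            ((homSol a b t ^ 2)⁻¹ * (1 + noiseVariance b c 1 t)) := by ring
      have hlt : M * (1 + C * Real.pi) / G < 1 := (div_lt_one hGpos).2 hk
      have hpos : 0 < (homSol a b t ^ 2)⁻¹ * (1 + noiseVariance b c 1 t) := by positivity
      rw [hrw] at hfin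
      exact absurd hfin (not_le.2 (mul_lt_of_lt_one_left hpos hlt))
    · rw [hu _ (by positivity), hu _ (by positivity), homSol_peak a b hk]
      have h34 : (3 * k * Real.pi : ℝ) ≤ 4 * k * Real.pi := by gcongr; norm_num
      have := (hJ 0 _ _ (by positivity) h34).2.1
      exact (mul_assoc _ _ _).symm.le.trans (by gcongr)
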